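/- For a positive integer $n$ let $\sigma_3(n)=\sum_{d\mid n} d^3$ be the sum of the cubes of the positive divisors of $n$, and put $\sigma_3(x)=0$ for every rational $x$ that is not a positive integer. For $q\in\mathbb{C}$ with $|q|<1$ let $$a(q)=\sum_{m,n\in\mathbb{Z}} q^{m^2+mn+n^2},\qquad E_4(q)=1+240\sum_{n=1}^{\infty}\sigma_3(n)\,q^n .$$ Then for every $q\in\mathbb{C}$ with $|q|<1$ all the series involved converge absolutely, and $$a(q)^4=1+24\sum_{n=1}^{\infty}\bigl(\sigma_3(n)+9\,\sigma_3(n/3)\bigr)q^n .$$ Moreover, $10\,a(q)^4=E_4(q)+9E_4(q^3)$. -/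

import Mathlib

open scoped ArithmeticFunction.sigma

/-- The general term `q ^ (m² + m n + n²)` of the double series `a(q)`; the integer exponent is
nonnegative, and it is `0` only for `m = n = 0`. -/
noncomputable def cubicThetaTerm (q : ℂ) (p : ℤ × ℤ) : ℂ :=
  q ^ (p.1 ^ 2 + p.1 * p.2 + p.2 ^ 2)

/-- The cubic theta function `a(q) = ∑_{m,n ∈ ℤ} q ^ (m² + m n + n²)`. -/
noncomputable def cubicTheta (q : ℂ) : ℂ :=
  ∑' p : ℤ × ℤ, cubicThetaTerm q p

/-- The divisor sum `σ_k(x)` of a rational argument: the sum of the `k`-th powers of the positive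
divisors of `x` if `x` is a positive integer, and `0` otherwise. -/
def sigmaRat (k : ℕ) (x : ℚ) : ℕ :=
  if x.den = 1 ∧ 0 < x then σ k x.num.toNat else 0

/-- The Eisenstein series `E₄(q) = 1 + 240 ∑_{n ≥ 1} σ₃(n) qⁿ`. -/
noncomputable def eisensteinFour (q : ℂ) : ℂ :=
  1 + 240 * ∑' n : ℕ+, (sigmaRat 3 (n : ℕ) : ℂ) * q ^ (n : ℕ)

/-! Write `E` for `eulerProduct` and `λ_n = q^n/(1-q^n)`. The proof is elementary and uses no
modular forms: `a` is expressed as a Lambert series, which is then squared twice.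

Lambert series for `a`. The Jacobi triple product and its `x d/dx` derivative
(`hasSum_finiteThetaTerm` and a limit) give three facts: Jacobi's series for `E(q)^3`, the
pentagonal series for `E(q)`, and the derivative of the latter, which is `-E(q) ∑ χ(n) λ_n` with `χ`
the character mod 3. Cubing the pentagonal series gives a second expansion of `E(q)^3`. Keep the
exponents divisible by 3 on both sides. The triple series factors as `E(q^3) a(q^3)`, while Jacobi's
series becomes the pentagonal series and its derivative at `q^3`. Dividing by `E` gives `a = 1 + 6 ∑
χ(n) λ_n` (`cubicTheta_eq_lambert`).

Squaring. The relation `λ_m λ_k = λ_{m+k} (1 + λ_m + λ_k)`, with product-to-sum formulas for `χ` and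
`c_n = cos(2πn/3)`, reduces `(∑ χ(n) λ_n)^2` to single Lambert series, so `a^2 = 1 + 8(S - C)` with
`S = ∑ n λ_n` and `C = ∑ n c_n λ_n`. The same device with weights evaluates `C^2 - 2SC` and, with `c
= 1`, `S^2 - 2S^2`. Their difference is `(S - C)^2`, so `a^4` is a combination of `∑ n^3 λ_n` and `∑
n^3 c_n λ_n`, that is, of the `σ_3` series at `q` and `q^3`. -/

open Filter Topology

/-! ### Finite and infinite q-products. -/

/-- The finite product `(q; q)_n`. -/
noncomputable def qPochhammer (q : ℂ) (n : ℕ) : ℂ := ∏ i ∈ Finset.range n, (1 - q ^ (i + 1))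

/-- The infinite product `(q; q)_∞`. -/
noncomputable def eulerProduct (q : ℂ) : ℂ := ∏' i : ℕ, (1 - q ^ (i + 1))

/-- The reciprocal of `(q; q)_m`, extended by zero to negative indices. -/
noncomputable def qPochhammerInv (q : ℂ) : ℤ → ℂ
  | Int.ofNat m => (qPochhammer q m)⁻¹
  | Int.negSucc _ => 0

theorem one_sub_pow_succ_ne_zero {q : ℂ} (hq : ‖q‖ < 1) (n : ℕ) : 1 - q ^ (n + 1) ≠ 0 := by
  intro h
  have h1 : ‖q ^ (n + 1)‖ = 1 := by rw [← sub_eq_zero.mp h, norm_one]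
  rw [norm_pow] at h1
  exact absurd h1 (pow_lt_one₀ (norm_nonneg _) hq (Nat.succ_ne_zero n)).ne

theorem qPochhammer_ne_zero {q : ℂ} (hq : ‖q‖ < 1) (n : ℕ) : qPochhammer q n ≠ 0 :=
  Finset.prod_ne_zero_iff.mpr fun i _ => one_sub_pow_succ_ne_zero hq i

theorem qPochhammer_succ (q : ℂ) (n : ℕ) :
    qPochhammer q (n + 1) = qPochhammer q n * (1 - q ^ (n + 1)) :=
  Finset.prod_range_succ _ _

theorem tendsto_qPochhammer {q : ℂ} (hq : ‖q‖ < 1) :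
    Tendsto (qPochhammer q) atTop (𝓝 (eulerProduct q)) :=
  (ModularForm.multipliable_one_sub_pow hq).hasProd.tendsto_prod_nat

theorem eulerProduct_ne_zero {q : ℂ} (hq : ‖q‖ < 1) : eulerProduct q ≠ 0 := by
  have := tprod_one_add_ne_zero_of_summable (f := fun n : ℕ => -q ^ (n + 1))
    (fun n => by simpa [sub_eq_add_neg] using one_sub_pow_succ_ne_zero hq n)
    (by simpa using (summable_nat_add_iff 1).mpr (summable_geometric_of_lt_one (norm_nonneg _) hq))
  simpa [eulerProduct, sub_eq_add_neg] using this

/-- The extension by zero is consistent: at `m = 0` the factor `1 - q^0` vanishes. The recursion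
therefore holds on all of `ℤ`, with no boundary cases in the triple product. -/
theorem qPochhammerInv_sub_one {q : ℂ} (hq : ‖q‖ < 1) (m : ℤ) :
    qPochhammerInv q (m - 1) = (1 - q ^ m) * qPochhammerInv q m := by
  rcases m with (_ | m) | m
  · have : Int.ofNat 0 - 1 = Int.negSucc 0 := rfl
    rw [this]
    simp [qPochhammerInv]
  · have : Int.ofNat (m + 1) - 1 = Int.ofNat m := by simp
    rw [this]
    have h1 := qPochhammer_ne_zero hq m
    have h2 := one_sub_pow_succ_ne_zero hq m
    simp only [qPochhammerInv, qPochhammer_succ, Int.ofNat_eq_natCast, zpow_natCast]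
    field_simp
  · have : Int.negSucc m - 1 = Int.negSucc (m + 1) := by omega
    rw [this]
    simp [qPochhammerInv]

theorem tendsto_qPochhammerInv {q : ℂ} (hq : ‖q‖ < 1) (j : ℤ) :
    Tendsto (fun n : ℕ => qPochhammerInv q (n + j)) atTop (𝓝 (eulerProduct q)⁻¹) := by
  have h1 : Tendsto (fun n : ℕ => (qPochhammer q ((n + j).toNat))⁻¹) atTop
      (𝓝 (eulerProduct q)⁻¹) := by
    refine ((tendsto_qPochhammer hq).comp ?_).inv₀ (eulerProduct_ne_zero hq)
    refine tendsto_atTop.mpr fun b => ?_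
    filter_upwards [eventually_ge_atTop (b + j.natAbs)] with n hn
    omega
  refine h1.congr' ?_
  filter_upwards [eventually_ge_atTop j.natAbs] with n hn
  obtain ⟨m, hm⟩ : ∃ m : ℕ, (n : ℤ) + j = m := ⟨(n + j).toNat, by omega⟩
  rw [hm]
  rfl

/-- This supplies the constant in the dominated convergence argument for the triple product. -/
theorem exists_norm_qPochhammerInv_le {q : ℂ} (hq : ‖q‖ < 1) :
    ∃ C : ℝ, 0 ≤ C ∧ ∀ m : ℤ, ‖qPochhammerInv q m‖ ≤ C := by
  have h1 : Tendsto (fun n : ℕ => (qPochhammer q n)⁻¹) atTop (𝓝 (eulerProduct q)⁻¹) :=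
    (tendsto_qPochhammer hq).inv₀ (eulerProduct_ne_zero hq)
  obtain ⟨C, hC⟩ := h1.norm.bddAbove_range
  refine ⟨max C 0, le_max_right _ _, fun m => ?_⟩
  rcases m with m | m
  · exact le_max_of_le_left (hC ⟨m, rfl⟩)
  · simp [qPochhammerInv]

/-! ### The Jacobi triple product and its derivative in `x`. -/

/-- The term `(-1)^j q^(j(j-1)/2) x^j` of the theta series. -/
noncomputable def thetaTerm (q x : ℂ) (j : ℤ) : ℂ := (-1) ^ j * q ^ (j * (j - 1) / 2) * x ^ j

theorem thetaTerm_succ {q x : ℂ} (hq : q ≠ 0) (hx : x ≠ 0) (j : ℤ) :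
    thetaTerm q x (j + 1) = -(q ^ j * x) * thetaTerm q x j := by
  have h : (j + 1) * (j + 1 - 1) / 2 = j * (j - 1) / 2 + j := by
    rw [show (j + 1) * (j + 1 - 1) = j * (j - 1) + j * 2 by ring,
      Int.add_mul_ediv_right _ _ (by norm_num)]
  rw [thetaTerm, thetaTerm, h, zpow_add₀ hq, zpow_add_one₀ hx, zpow_add_one₀ (by norm_num)]
  ring

/-- The finite theta product `∏_{k < n} (1 - x q^k) (1 - q^(k+1) / x)`. -/
noncomputable def thetaProd (q x : ℂ) (n : ℕ) : ℂ :=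
  ∏ k ∈ Finset.range n, ((1 - x * q ^ k) * (1 - q ^ (k + 1) / x))

/-- The logarithmic derivative `x d/dx` of the finite theta product, computed recursively. -/
noncomputable def thetaProdDeriv (q x : ℂ) : ℕ → ℂ
  | 0 => 0
  | n + 1 => thetaProdDeriv q x n * ((1 - x * q ^ n) * (1 - q ^ (n + 1) / x)) +
      thetaProd q x n * (q ^ (n + 1) / x - x * q ^ n)

/-- The summand of the finite Jacobi triple product. -/
noncomputable def finiteThetaTerm (q x : ℂ) (n : ℕ) (j : ℤ) : ℂ :=
  qPochhammer q (2 * n) * (thetaTerm q x j * (qPochhammerInv q (n + j) * qPochhammerInv q (n - j)))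

/-- Comparison of coefficients of `x^j` after multiplication by `(1 - x q^n)(1 - q^(n+1)/x)`. Once
all reciprocals are expressed through those of index `n+1+j` and `n+1-j`, it is a rational identity
in `q^n` and `q^j`. -/
theorem finiteThetaTerm_succ {q x : ℂ} (hq : ‖q‖ < 1) (hq0 : q ≠ 0) (hx : x ≠ 0) (n : ℕ) (j : ℤ) :
    finiteThetaTerm q x (n + 1) j = (1 + q ^ (2 * n + 1)) * finiteThetaTerm q x n j -
      x * q ^ n * finiteThetaTerm q x n (j - 1) -
      q ^ (n + 1) / x * finiteThetaTerm q x n (j + 1) := by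
  have e1 := qPochhammerInv_sub_one hq (n + 1 + j)
  have e2 := qPochhammerInv_sub_one hq (n + 1 - j)
  have e3 := qPochhammerInv_sub_one hq (n + j)
  have e4 := qPochhammerInv_sub_one hq (n - j)
  have t1 := thetaTerm_succ hq0 hx (j - 1)
  have t2 := thetaTerm_succ hq0 hx j
  rw [sub_add_cancel] at t1
  rw [show (n : ℤ) + 1 + j - 1 = n + j by ring] at e1
  rw [show (n : ℤ) + 1 - j - 1 = n - j by ring] at e2
  have hb : q ^ j ≠ 0 := zpow_ne_zero _ hq0
  have ha : q ^ n ≠ 0 := pow_ne_zero _ hq0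
  simp only [finiteThetaTerm]
  rw [show 2 * (n + 1) = 2 * n + 1 + 1 by ring, qPochhammer_succ, qPochhammer_succ, Nat.cast_succ,
    show (n : ℤ) + (j - 1) = n + j - 1 by ring, show (n : ℤ) - (j - 1) = n + 1 - j by ring,
    show (n : ℤ) + (j + 1) = n + 1 + j by ring, show (n : ℤ) - (j + 1) = n - j - 1 by ring,
    e3, e4, e1, e2, t2, t1]
  have p1 : q ^ ((n : ℤ) + 1 + j) = q ^ n * q * q ^ j := by
    rw [zpow_add₀ hq0, zpow_add₀ hq0]; simp
  have p2 : q ^ ((n : ℤ) + 1 - j) = q ^ n * q / q ^ j := by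
    rw [zpow_sub₀ hq0, zpow_add₀ hq0]; simp
  have p3 : q ^ ((n : ℤ) + j) = q ^ n * q ^ j := by
    rw [zpow_add₀ hq0]; simp
  have p4 : q ^ ((n : ℤ) - j) = q ^ n / q ^ j := by
    rw [zpow_sub₀ hq0]; simp
  have p5 : q ^ (j - 1) = q ^ j / q := by
    rw [zpow_sub₀ hq0]; simp
  rw [p1, p2, p3, p4, p5]
  have p6 : q ^ (2 * n + 1) = q ^ n * q ^ n * q := by ring
  have p7 : q ^ (2 * n + 1 + 1) = q ^ n * q ^ n * q * q := by ring
  have p8 : q ^ (n + 1) = q ^ n * q := by ring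
  rw [p6, p7, p8]
  generalize q ^ n = a at *
  generalize q ^ j = b at *
  generalize qPochhammerInv q ((n : ℤ) + 1 + j) = A
  generalize qPochhammerInv q ((n : ℤ) + 1 - j) = B
  generalize thetaTerm q x (j - 1) = t
  field_simp
  ring

/-- The finite form of the Jacobi triple product identity, and its derivative. -/
theorem hasSum_finiteThetaTerm {q x : ℂ} (hq : ‖q‖ < 1) (hq0 : q ≠ 0) (hx : x ≠ 0) (n : ℕ) :
    HasSum (finiteThetaTerm q x n) (thetaProd q x n) ∧
      HasSum (fun j : ℤ => (j : ℂ) * finiteThetaTerm q x n j) (thetaProdDeriv q x n) := by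
  induction n with
  | zero =>
    -- One of the indices `j`, `-j` is negative, so one reciprocal factor is zero.
    have h : ∀ j : ℤ, j ≠ 0 → finiteThetaTerm q x 0 j = 0 := by
      intro j hj
      rcases lt_or_gt_of_ne hj with h | h
      · obtain ⟨m, rfl⟩ := Int.eq_negSucc_of_lt_zero h
        simp [finiteThetaTerm, qPochhammerInv]
      · obtain ⟨m, hm⟩ := Int.eq_negSucc_of_lt_zero (Int.neg_neg_of_pos h)
        simp [finiteThetaTerm, hm, qPochhammerInv]
    constructor
    · convert hasSum_single (0 : ℤ) h
      have : qPochhammerInv q 0 = (qPochhammer q 0)⁻¹ := rfl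
      simp [finiteThetaTerm, this, thetaTerm, thetaProd, qPochhammer]
    · convert hasSum_single (0 : ℤ) fun j hj => ?_
      · simp [thetaProdDeriv]
      · rw [h j hj, mul_zero]
  | succ n ih =>
    obtain ⟨h1, h2⟩ := ih
    have hm : HasSum (fun j : ℤ => finiteThetaTerm q x n (j - 1)) (thetaProd q x n) :=
      (Equiv.hasSum_iff (f := finiteThetaTerm q x n)
        (Equiv.subRight (1 : ℤ))).mpr h1
    have hp : HasSum (fun j : ℤ => finiteThetaTerm q x n (j + 1)) (thetaProd q x n) :=
      (Equiv.hasSum_iff (f := finiteThetaTerm q x n)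
        (Equiv.addRight (1 : ℤ))).mpr h1
    have hm' : HasSum (fun j : ℤ => ((j - 1 : ℤ) : ℂ) * finiteThetaTerm q x n (j - 1))
      (thetaProdDeriv q x n) := (Equiv.hasSum_iff (f := fun j : ℤ => (j : ℂ) * finiteThetaTerm q x n j)
        (Equiv.subRight (1 : ℤ))).mpr h2
    have hp' : HasSum (fun j : ℤ => ((j + 1 : ℤ) : ℂ) * finiteThetaTerm q x n (j + 1))
      (thetaProdDeriv q x n) := (Equiv.hasSum_iff (f := fun j : ℤ => (j : ℂ) * finiteThetaTerm q x n j)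
        (Equiv.addRight (1 : ℤ))).mpr h2
    have v1 : thetaProd q x (n + 1) = (1 + q ^ (2 * n + 1)) * thetaProd q x n -
        x * q ^ n * thetaProd q x n - q ^ (n + 1) / x * thetaProd q x n := by
      have : thetaProd q x (n + 1) =
          thetaProd q x n * ((1 - x * q ^ n) * (1 - q ^ (n + 1) / x)) :=
        Finset.prod_range_succ _ _
      rw [this]
      field_simp
      ring
    have v2 : thetaProdDeriv q x (n + 1) = (1 + q ^ (2 * n + 1)) * thetaProdDeriv q x n -
        x * q ^ n * (thetaProdDeriv q x n + thetaProd q x n) -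
        q ^ (n + 1) / x * (thetaProdDeriv q x n - thetaProd q x n) := by
      rw [thetaProdDeriv]
      field_simp
      ring
    rw [v1, v2]
    constructor
    · rw [funext (finiteThetaTerm_succ hq hq0 hx n)]
      exact ((h1.mul_left _).sub (hm.mul_left _)).sub (hp.mul_left _)
    · have e : (fun j : ℤ => (j : ℂ) * finiteThetaTerm q x (n + 1) j) = fun j : ℤ =>
          (1 + q ^ (2 * n + 1)) * ((j : ℂ) * finiteThetaTerm q x n j) -
          x * q ^ n * (((j - 1 : ℤ) : ℂ) * finiteThetaTerm q x n (j - 1) +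
            finiteThetaTerm q x n (j - 1)) -
          q ^ (n + 1) / x * (((j + 1 : ℤ) : ℂ) * finiteThetaTerm q x n (j + 1) -
            finiteThetaTerm q x n (j + 1)) := by
        refine funext fun j => ?_
        rw [finiteThetaTerm_succ hq hq0 hx n j]
        push_cast
        ring
      rw [e]
      exact ((h2.mul_left _).sub ((hm'.add hm).mul_left _)).sub ((hp'.sub hp).mul_left _)

theorem summable_abs_mul_norm_thetaTerm {q x : ℂ} (hq : ‖q‖ < 1) (hq0 : q ≠ 0) (hx : x ≠ 0)
    (k : ℕ) : Summable fun j : ℤ => (|j| ^ k : ℝ) * ‖thetaTerm q x j‖ := by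
  have hq' : 0 < ‖q‖ := norm_pos_iff.mpr hq0
  have hx' : 0 < ‖x‖ := norm_pos_iff.mpr hx
  set l := -Real.log ‖q‖ with hl
  have hl0 : 0 < l := neg_pos.mpr (Real.log_neg hq' hq)
  -- The parameters are chosen so that the Gaussian bound has exponent `-(l/2) j^2 + (l/2 + |log
  -- ‖x‖|) |j|`, which dominates the logarithm of the norm of the theta term.
  have hs := summable_pow_mul_jacobiTheta₂_term_bound ((l / 2 + |Real.log ‖x‖|) / (2 * Real.pi))
    (T := l / (2 * Real.pi)) (by positivity) k
  refine hs.of_nonneg_of_le (fun j => by positivity) fun j => ?_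
  push_cast
  refine mul_le_mul_of_nonneg_left ?_ (by positivity)
  have he : ((j * (j - 1) / 2 : ℤ) : ℝ) = (j : ℝ) * (j - 1) / 2 := by
    rw [Int.cast_div (by simpa using (Int.even_mul_pred_self j).two_dvd) (by norm_num)]
    push_cast
    ring
  rw [thetaTerm, norm_mul, norm_mul, norm_zpow, norm_zpow, norm_zpow, norm_neg, norm_one,
    one_zpow, one_mul, ← Real.rpow_intCast, ← Real.rpow_intCast, Real.rpow_def_of_pos hq',
    Real.rpow_def_of_pos hx', ← Real.exp_add, he]
  refine Real.exp_le_exp.mpr ?_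
  have h1 : Real.log ‖x‖ * j ≤ |Real.log ‖x‖| * |(j : ℝ)| := by
    rw [← abs_mul]; exact le_abs_self _
  have h2 : l * j ≤ l * |(j : ℝ)| := mul_le_mul_of_nonneg_left (le_abs_self _) hl0.le
  have h3 : -Real.pi * (l / (2 * Real.pi) * (j : ℝ) ^ 2 -
      2 * ((l / 2 + |Real.log ‖x‖|) / (2 * Real.pi)) * |(j : ℝ)|) =
      -(l / 2) * j ^ 2 + (l / 2 + |Real.log ‖x‖|) * |(j : ℝ)| := by
    have := Real.pi_ne_zero
    field_simp
    ring
  rw [h3, show Real.log ‖q‖ = -l by simp [hl]]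
  nlinarith

theorem summable_pow_mul_thetaTerm {q x : ℂ} (hq : ‖q‖ < 1) (hq0 : q ≠ 0) (hx : x ≠ 0)
    (k : ℕ) : Summable fun j : ℤ => (j : ℂ) ^ k * thetaTerm q x j := by
  refine Summable.of_norm ?_
  simpa using summable_abs_mul_norm_thetaTerm hq hq0 hx k

/-- Dominated convergence: `(q;q)_{2n}` tends to `E` and each of the two reciprocals to `1/E`, which
leaves one factor `1/E`. The case `k = 0` serves the product and `k = 1` its derivative. -/
theorem tendsto_tsum_finiteThetaTerm {q x : ℂ} (hq : ‖q‖ < 1) (hq0 : q ≠ 0) (hx : x ≠ 0) (k : ℕ) :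
    Tendsto (fun n => ∑' j : ℤ, (j : ℂ) ^ k * finiteThetaTerm q x n j) atTop
      (𝓝 ((∑' j : ℤ, (j : ℂ) ^ k * thetaTerm q x j) / eulerProduct q)) := by
  obtain ⟨C, hC0, hC⟩ := exists_norm_qPochhammerInv_le hq
  have hE := eulerProduct_ne_zero hq
  have h := tendsto_tsum_of_dominated_convergence
    (f := fun (n : ℕ) (j : ℤ) => (j : ℂ) ^ k *
      (thetaTerm q x j * (qPochhammerInv q (n + j) * qPochhammerInv q (n - j))))
    (g := fun j : ℤ => (j : ℂ) ^ k * (thetaTerm q x j * ((eulerProduct q)⁻¹ * (eulerProduct q)⁻¹)))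
    (𝓕 := atTop)
    (bound := fun j : ℤ => (|j| ^ k : ℝ) * ‖thetaTerm q x j‖ * (C * C))
    ((summable_abs_mul_norm_thetaTerm hq hq0 hx k).mul_right _)
    (fun j => ((((tendsto_qPochhammerInv hq j).mul
      (by simpa [sub_eq_add_neg] using tendsto_qPochhammerInv hq (-j))).const_mul _).const_mul _))
    (Eventually.of_forall fun n j => by
      rw [norm_mul, norm_mul, norm_mul, norm_pow, mul_assoc]
      have : ‖(j : ℂ)‖ = |(j : ℝ)| := by simp
      rw [this]
      push_cast
      gcongr <;> apply hC)
  have h2 := ((tendsto_qPochhammer hq).comp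
    (tendsto_id.const_mul_atTop' (by norm_num : 0 < 2))).mul h
  convert h2 using 2 with n
  · rw [← tsum_mul_left]
    refine tsum_congr fun j => ?_
    simp [finiteThetaTerm]
    ring
  · simp_rw [← mul_assoc]
    rw [tsum_mul_right, tsum_mul_right]
    field_simp

/-- The Jacobi triple product identity. -/
theorem tendsto_thetaProd {q x : ℂ} (hq : ‖q‖ < 1) (hq0 : q ≠ 0) (hx : x ≠ 0) :
    Tendsto (thetaProd q x) atTop (𝓝 ((∑' j : ℤ, thetaTerm q x j) / eulerProduct q)) := by
  have h := tendsto_tsum_finiteThetaTerm hq hq0 hx 0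
  simp only [pow_zero, one_mul] at h
  exact h.congr fun n => (hasSum_finiteThetaTerm hq hq0 hx n).1.tsum_eq

theorem tendsto_thetaProdDeriv {q x : ℂ} (hq : ‖q‖ < 1) (hq0 : q ≠ 0) (hx : x ≠ 0) :
    Tendsto (thetaProdDeriv q x) atTop
      (𝓝 ((∑' j : ℤ, (j : ℂ) * thetaTerm q x j) / eulerProduct q)) := by
  have h := tendsto_tsum_finiteThetaTerm hq hq0 hx 1
  simp only [pow_one] at h
  exact h.congr fun n => (hasSum_finiteThetaTerm hq hq0 hx n).2.tsum_eq

/-- Jacobi's identity for the cube of the Euler product. -/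
theorem eulerProduct_pow_three {q : ℂ} (hq : ‖q‖ < 1) (hq0 : q ≠ 0) :
    eulerProduct q ^ 3 = -∑' j : ℤ, (j : ℂ) * thetaTerm q 1 j := by
  have hE := eulerProduct_ne_zero hq
  have h0 : ∀ n, thetaProd q 1 (n + 1) = 0 := fun n => by
    rw [thetaProd, Finset.prod_range_succ']
    simp
  -- At `x = 1` the factor `1 - x` vanishes, so only its own derivative survives, multiplied by all
  -- the remaining factors. The limit is `-E^2`.
  have h1 : ∀ n, thetaProdDeriv q 1 (n + 1) = -(qPochhammer q n * qPochhammer q (n + 1)) := by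
    intro n
    induction n with
    | zero => simp [thetaProdDeriv, thetaProd, qPochhammer]
    | succ n ih =>
      rw [thetaProdDeriv, ih, h0, qPochhammer_succ q (n + 1), qPochhammer_succ q n]
      ring
  have h2 := (tendsto_add_atTop_iff_nat 1).mpr
    (tendsto_thetaProdDeriv (x := 1) hq hq0 one_ne_zero)
  have h3 := ((tendsto_qPochhammer hq).mul
    ((tendsto_add_atTop_iff_nat 1).mpr (tendsto_qPochhammer hq))).neg
  have h4 := tendsto_nhds_unique h2 (h3.congr fun n => (h1 n).symm)
  rw [div_eq_iff hE] at h4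
  rw [h4]
  ring

/-! ### Lambert terms and the pentagonal series, with base `q^3` and `x = q`. -/

/-- The Lambert term `q^n / (1 - q^n)`. -/
noncomputable def lambertTerm (q : ℂ) (n : ℕ) : ℂ := q ^ n / (1 - q ^ n)

/-- The nontrivial Dirichlet character modulo `3`. -/
noncomputable def chiThree (n : ℕ) : ℂ := if n % 3 = 0 then 0 else if n % 3 = 1 then 1 else -1

theorem norm_chiThree_le (n : ℕ) : ‖chiThree n‖ ≤ 1 := by
  unfold chiThree
  split_ifs <;> simp

theorem summable_pow_mul_lambertTerm {q : ℂ} (hq : ‖q‖ < 1) (k : ℕ) :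
    Summable fun n : ℕ => (n : ℂ) ^ k * lambertTerm q n := by
  simpa only [lambertTerm, mul_div_assoc] using summable_norm_pow_mul_geometric_div_one_sub k hq

theorem summable_mul_lambertTerm {q : ℂ} (hq : ‖q‖ < 1) {c : ℕ → ℂ} {K : ℝ} {k : ℕ}
    (hc : ∀ n, ‖c n‖ ≤ K * n ^ k) : Summable fun n : ℕ => c n * lambertTerm q n := by
  refine Summable.of_norm_bounded ((summable_pow_mul_lambertTerm hq k).norm.mul_left K) fun n => ?_
  rw [norm_mul, norm_mul, norm_pow, ← mul_assoc]
  gcongr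
  simpa using hc n

/-- The three factor families `1 - q^i` with `i ≡ 0, 1, 2` mod 3 reassemble `(q;q)_{3n}`. -/
theorem thetaProd_cube_self {q : ℂ} (hq0 : q ≠ 0) (n : ℕ) :
    qPochhammer (q ^ 3) n * thetaProd (q ^ 3) q n = qPochhammer q (3 * n) := by
  induction n with
  | zero => simp [qPochhammer, thetaProd]
  | succ n ih =>
    have : thetaProd (q ^ 3) q (n + 1) = thetaProd (q ^ 3) q n *
        ((1 - q * (q ^ 3) ^ n) * (1 - (q ^ 3) ^ (n + 1) / q)) := Finset.prod_range_succ _ _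
    rw [this, show 3 * (n + 1) = 3 * n + 1 + 1 + 1 by ring, qPochhammer_succ, qPochhammer_succ,
      qPochhammer_succ, qPochhammer_succ, ← ih,
      show (q ^ 3) ^ (n + 1) / q = q ^ (3 * n + 1 + 1) by field_simp; ring]
    ring

theorem tendsto_three_mul_atTop : Tendsto (fun n : ℕ => 3 * n) atTop atTop :=
  tendsto_id.const_mul_atTop' (by norm_num)

theorem norm_cube_lt_one {q : ℂ} (hq : ‖q‖ < 1) : ‖q ^ 3‖ < 1 := by
  rw [norm_pow]
  exact pow_lt_one₀ (norm_nonneg _) hq (by norm_num)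

theorem tendsto_thetaProd_cube {q : ℂ} (hq : ‖q‖ < 1) (hq0 : q ≠ 0) :
    Tendsto (thetaProd (q ^ 3) q) atTop (𝓝 (eulerProduct q / eulerProduct (q ^ 3))) := by
  have h3 := norm_cube_lt_one hq
  refine (((tendsto_qPochhammer hq).comp tendsto_three_mul_atTop).div
    (tendsto_qPochhammer h3) (eulerProduct_ne_zero h3)).congr fun n => ?_
  simp only [Function.comp, Pi.div_apply]
  rw [← thetaProd_cube_self hq0, mul_div_cancel_left₀ _ (qPochhammer_ne_zero h3 n)]

/-- Euler's pentagonal number theorem. -/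
theorem tsum_thetaTerm_cube {q : ℂ} (hq : ‖q‖ < 1) (hq0 : q ≠ 0) :
    ∑' j : ℤ, thetaTerm (q ^ 3) q j = eulerProduct q := by
  have h3 := norm_cube_lt_one hq
  have h := tendsto_nhds_unique (tendsto_thetaProd h3 (pow_ne_zero 3 hq0) hq0)
    (tendsto_thetaProd_cube hq hq0)
  rwa [div_left_inj' (eulerProduct_ne_zero h3)] at h

/-- Logarithmic differentiation at `x = q`: the factors `1 - x q^(3k)` contribute `-λ_{3k+1}` and
the factors `1 - q^(3k+3)/x` contribute `+λ_{3k+2}`. This is where the character mod 3 enters. -/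
theorem thetaProdDeriv_cube {q : ℂ} (hq : ‖q‖ < 1) (hq0 : q ≠ 0) (n : ℕ) :
    thetaProdDeriv (q ^ 3) q n =
      -(thetaProd (q ^ 3) q n * ∑ m ∈ Finset.range (3 * n), chiThree m * lambertTerm q m) := by
  induction n with
  | zero => simp [thetaProdDeriv]
  | succ n ih =>
    have : thetaProd (q ^ 3) q (n + 1) = thetaProd (q ^ 3) q n *
        ((1 - q * (q ^ 3) ^ n) * (1 - (q ^ 3) ^ (n + 1) / q)) := Finset.prod_range_succ _ _
    rw [thetaProdDeriv, ih, this, show 3 * (n + 1) = 3 * n + 1 + 1 + 1 by ring,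
      Finset.sum_range_succ, Finset.sum_range_succ, Finset.sum_range_succ,
      show (q ^ 3) ^ (n + 1) / q = q ^ (3 * n + 1 + 1) by field_simp; ring,
      show q * (q ^ 3) ^ n = q ^ (3 * n + 1) by ring]
    have c0 : chiThree (3 * n) = 0 := by simp [chiThree]
    have c1 : chiThree (3 * n + 1) = 1 := by
      rw [chiThree, if_neg (by omega), if_pos (by omega)]
    have c2 : chiThree (3 * n + 1 + 1) = -1 := by
      rw [chiThree, if_neg (by omega), if_neg (by omega)]
    rw [c0, c1, c2, lambertTerm.eq_1 q (3 * n + 1 + 1), lambertTerm.eq_1 q (3 * n + 1)]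
    have h1 := one_sub_pow_succ_ne_zero hq (3 * n)
    have h2 := one_sub_pow_succ_ne_zero hq (3 * n + 1)
    field_simp
    ring

theorem tsum_mul_thetaTerm_cube {q : ℂ} (hq : ‖q‖ < 1) (hq0 : q ≠ 0) :
    ∑' j : ℤ, (j : ℂ) * thetaTerm (q ^ 3) q j =
      -(eulerProduct q * ∑' n : ℕ, chiThree n * lambertTerm q n) := by
  have h3 := norm_cube_lt_one hq
  have hs : Summable fun n : ℕ => chiThree n * lambertTerm q n :=
    summable_mul_lambertTerm hq (K := 1) (k := 0) fun n => by simpa using norm_chiThree_le n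
  have h1 := ((tendsto_thetaProd_cube hq hq0).mul
    (hs.hasSum.tendsto_sum_nat.comp tendsto_three_mul_atTop)).neg
  have h := tendsto_nhds_unique (tendsto_thetaProdDeriv h3 (pow_ne_zero 3 hq0) hq0)
    (h1.congr fun n => (thetaProdDeriv_cube hq hq0 n).symm)
  have hE := eulerProduct_ne_zero h3
  field_simp at h
  exact h

/-! ### Convergence of the cubic theta series and its 3-dissection. -/

theorem summable_pow_natAbs {r : ℝ} (hr0 : 0 ≤ r) (hr : r < 1) :
    Summable fun x : ℤ => r ^ x.natAbs := by
  have := summable_geometric_of_lt_one hr0 hr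
  exact Summable.of_nat_of_neg (by simpa using this) (by simpa using this)

/-- Since `2(x^2 + xy + y^2) = x^2 + y^2 + (x+y)^2 ≥ |x| + |y|`, with `r = √‖q‖` each term is at
most `r^|x| r^|y|`. -/
theorem summable_cubicThetaTerm {q : ℂ} (hq : ‖q‖ < 1) : Summable (cubicThetaTerm q) := by
  set r := √‖q‖ with hr
  have hr0 : 0 ≤ r := Real.sqrt_nonneg _
  have hr1 : r < 1 := by rw [hr, Real.sqrt_lt' one_pos]; simpa using hq
  have hs := summable_pow_natAbs hr0 hr1
  refine Summable.of_norm_bounded (hs.mul_of_nonneg hs (fun _ => by positivity)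
    fun _ => by positivity) fun ⟨x, y⟩ => ?_
  have hN : 0 ≤ x ^ 2 + x * y + y ^ 2 := by nlinarith [sq_nonneg (x + y), sq_nonneg x, sq_nonneg y]
  obtain ⟨N, hN'⟩ := Int.eq_ofNat_of_zero_le hN
  have hq2 : ‖q‖ = r ^ 2 := (Real.sq_sqrt (norm_nonneg q)).symm
  rw [cubicThetaTerm, hN', zpow_natCast, norm_pow, hq2, ← pow_mul, ← pow_add]
  refine pow_le_pow_of_le_one hr0 hr1.le ?_
  have hz (z : ℤ) : (z.natAbs : ℤ) ≤ z ^ 2 := by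
    rw [← Int.natAbs_sq]
    exact_mod_cast Nat.le_self_pow (by norm_num) _
  have hx := hz x
  have hy := hz y
  zify at *
  nlinarith [sq_nonneg (x + y)]

theorem thetaTerm_mul_right (q x w : ℂ) (j : ℤ) : thetaTerm q (w * x) j = w ^ j * thetaTerm q x j := by
  rw [thetaTerm, thetaTerm, mul_zpow]
  ring

theorem thetaTerm_mul_left (q x w : ℂ) (j : ℤ) :
    thetaTerm (w * q) x j = w ^ (j * (j - 1) / 2) * thetaTerm q x j := by
  rw [thetaTerm, thetaTerm, mul_zpow]
  ring

theorem root_of_unity_filter {w : ℂ} (hw3 : w ^ 3 = 1) (hw : w ≠ 1) (e : ℤ) :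
    1 + w ^ e + (w ^ 2) ^ e = if e % 3 = 0 then 3 else 0 := by
  have hw0 : w ≠ 0 := by rintro rfl; norm_num at hw3
  have hs : 1 + w + w ^ 2 = 0 := by
    have : (w - 1) * (1 + w + w ^ 2) = 0 := by linear_combination hw3
    exact (mul_eq_zero.mp this).resolve_left (sub_ne_zero.mpr hw)
  have he : w ^ e = w ^ (e % 3) := by
    conv_lhs => rw [← Int.mul_ediv_add_emod e 3]
    rw [zpow_add₀ hw0, zpow_mul]
    norm_cast
    simp [hw3]
  rw [← zpow_natCast, ← zpow_mul, mul_comm, zpow_mul, he]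
  have h1 : e % 3 = 0 ∨ e % 3 = 1 ∨ e % 3 = 2 := by omega
  rcases h1 with h | h | h <;> rw [h]
  · norm_num
  · simpa using hs
  · norm_cast
    simp only [if_false]
    push_cast
    linear_combination hs + w * hw3

theorem neg_one_zpow_add_two_mul (a b : ℤ) : (-1 : ℂ) ^ (a + 2 * b) = (-1) ^ a := by
  rw [zpow_add₀ (by norm_num), zpow_mul]
  norm_num

theorem two_mul_mul_pred_ediv_two (j : ℤ) : 2 * (j * (j - 1) / 2) = j * (j - 1) :=
  Int.two_mul_ediv_two_of_even (Int.even_mul_pred_self j)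

theorem cube_zpow (q : ℂ) (e : ℤ) : (q ^ 3) ^ e = q ^ (3 * e) := by
  rw [zpow_mul]
  norm_cast

theorem thetaTerm_cube_self {q : ℂ} (hq0 : q ≠ 0) (j : ℤ) :
    thetaTerm (q ^ 3) q j = (-1) ^ j * q ^ (3 * (j * (j - 1) / 2) + j) := by
  rw [thetaTerm, cube_zpow, zpow_add₀ hq0, mul_assoc]

/-- Jacobi's terms at multiples of 3 are pentagonal terms in `q^3`; the symmetry `j ↦ 1 - j` below
brings the class `j ≡ 1` to this one. -/
theorem thetaTerm_one_three_mul {q : ℂ} (hq0 : q ≠ 0) (m : ℤ) :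
    thetaTerm q 1 (3 * m) = thetaTerm ((q ^ 3) ^ 3) (q ^ 3) m := by
  rw [thetaTerm_cube_self (pow_ne_zero 3 hq0), thetaTerm, cube_zpow, one_zpow, mul_one,
    show 3 * m = m + 2 * m by ring, neg_one_zpow_add_two_mul]
  congr 2
  have h1 := two_mul_mul_pred_ediv_two (m + 2 * m)
  have h2 := two_mul_mul_pred_ediv_two m
  refine mul_left_cancel₀ (two_ne_zero) (h1.trans ?_)
  linear_combination -9 * h2

theorem thetaTerm_one_sub {q : ℂ} (j : ℤ) : thetaTerm q 1 (1 - j) = -thetaTerm q 1 j := by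
  rw [thetaTerm, thetaTerm, show (1 - j) * (1 - j - 1) = j * (j - 1) by ring, one_zpow, one_zpow,
    show 1 - j = 1 + j + 2 * (-j) by ring, neg_one_zpow_add_two_mul, zpow_add₀ (by norm_num)]
  ring

/-- The product of three pentagonal terms, in coordinates adapted to the sublattice
where the three indices add up to a multiple of `3`. -/
theorem thetaTerm_cube_mul_mul {q : ℂ} (hq0 : q ≠ 0) (n x y : ℤ) :
    thetaTerm (q ^ 3) q (n + x) * (thetaTerm (q ^ 3) q (n + y) * thetaTerm (q ^ 3) q (n - x - y)) =
      thetaTerm ((q ^ 3) ^ 3) (q ^ 3) n * cubicThetaTerm (q ^ 3) (x, y) := by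
  rw [thetaTerm_cube_self (pow_ne_zero 3 hq0), thetaTerm_cube_self hq0, thetaTerm_cube_self hq0,
    thetaTerm_cube_self hq0, cubicThetaTerm, cube_zpow, cube_zpow]
  have hsign : (-1 : ℂ) ^ (n + x) * (-1) ^ (n + y) * (-1) ^ (n - x - y) = (-1) ^ n := by
    rw [← zpow_add₀ (by norm_num), ← zpow_add₀ (by norm_num),
      show n + x + (n + y) + (n - x - y) = n + 2 * n by ring, neg_one_zpow_add_two_mul]
  have hA := two_mul_mul_pred_ediv_two (n + x)
  have hB := two_mul_mul_pred_ediv_two (n + y)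
  have hC := two_mul_mul_pred_ediv_two (n - x - y)
  have hn := two_mul_mul_pred_ediv_two n
  generalize (n + x) * (n + x - 1) / 2 = a at *
  generalize (n + y) * (n + y - 1) / 2 = b at *
  generalize (n - x - y) * (n - x - y - 1) / 2 = c at *
  generalize n * (n - 1) / 2 = d at *
  -- The three indices sum to `3n` and their squares to `3n^2 + 2(x^2 + xy + y^2)`; the pentagonal
  -- exponent is `(3j^2 - j)/2`.
  have hexp : (3 * a + (n + x)) + (3 * b + (n + y)) + (3 * c + (n - x - y)) =
      3 * (3 * d + n) + 3 * (x ^ 2 + x * y + y ^ 2) := by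
    refine mul_left_cancel₀ (two_ne_zero (α := ℤ)) ?_
    linear_combination 3 * hA + 3 * hB + 3 * hC - 9 * hn
  have hpow : q ^ (3 * a + (n + x)) * q ^ (3 * b + (n + y)) * q ^ (3 * c + (n - x - y)) =
      q ^ (3 * (3 * d + n)) * q ^ (3 * (x ^ 2 + x * y + y ^ 2)) := by
    rw [← zpow_add₀ hq0, ← zpow_add₀ hq0, ← zpow_add₀ hq0, hexp]
  rw [← hsign, mul_assoc _ (q ^ (3 * (3 * d + n))), ← hpow]
  generalize q ^ (3 * a + (n + x)) = u, q ^ (3 * b + (n + y)) = v, q ^ (3 * c + (n - x - y)) = w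
  ring

theorem exists_primitive_cube_root : ∃ w : ℂ, w ^ 3 = 1 ∧ w ≠ 1 := by
  have h := Complex.isPrimitiveRoot_exp 3 (by norm_num)
  exact ⟨_, h.pow_eq_one, h.ne_one (by norm_num)⟩

/-- The sum over a root-of-unity filter picks out the indices on which `e` is divisible by `3`. -/
theorem tsum_filter_three {ι : Type*} {f : ι → ℂ} (hf : Summable f) (e : ι → ℤ) {w : ℂ}
    (hw3 : w ^ 3 = 1) (hw : w ≠ 1) :
    (∑' i, f i) + (∑' i, w ^ e i * f i) + ∑' i, (w ^ 2) ^ e i * f i =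
      3 * ∑' i, if e i % 3 = 0 then f i else 0 := by
  have hn : ‖w‖ = 1 := Complex.norm_eq_one_of_pow_eq_one hw3 (by norm_num)
  have h1 : Summable fun i => w ^ e i * f i :=
    Summable.of_norm (by simpa [norm_mul, norm_zpow, hn] using hf.norm)
  have h2 : Summable fun i => (w ^ 2) ^ e i * f i :=
    Summable.of_norm (by simpa [norm_mul, norm_zpow, norm_pow, hn] using hf.norm)
  rw [← hf.tsum_add h1, ← (hf.add h1).tsum_add h2, ← tsum_mul_left]
  refine tsum_congr fun i => ?_
  have := root_of_unity_filter hw3 hw (e i)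
  rw [← one_mul (f i), ← mul_assoc, ← mul_assoc, mul_one, mul_one, ← add_mul, ← add_mul, this]
  split_ifs <;> ring

theorem summable_thetaTerm_cube {q : ℂ} (hq : ‖q‖ < 1) (hq0 : q ≠ 0) :
    Summable (thetaTerm (q ^ 3) q) := by
  simpa using summable_pow_mul_thetaTerm (norm_cube_lt_one hq) (pow_ne_zero 3 hq0) hq0 0

theorem summable_thetaTerm_triple {q : ℂ} (hq : ‖q‖ < 1) (hq0 : q ≠ 0) :
    Summable fun p : ℤ × ℤ × ℤ =>
      thetaTerm (q ^ 3) q p.1 * (thetaTerm (q ^ 3) q p.2.1 * thetaTerm (q ^ 3) q p.2.2) := by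
  have hs := (summable_thetaTerm_cube hq hq0).norm
  have h2 : Summable fun p : ℤ × ℤ => thetaTerm (q ^ 3) q p.1 * thetaTerm (q ^ 3) q p.2 :=
    summable_mul_of_summable_norm hs hs
  exact summable_mul_of_summable_norm (f := thetaTerm (q ^ 3) q)
    (g := fun p : ℤ × ℤ => thetaTerm (q ^ 3) q p.1 * thetaTerm (q ^ 3) q p.2) hs h2.norm

theorem eulerProduct_pow_three_eq_triple {q : ℂ} (hq : ‖q‖ < 1) (hq0 : q ≠ 0) :
    eulerProduct q ^ 3 = ∑' p : ℤ × ℤ × ℤ,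
      thetaTerm (q ^ 3) q p.1 * (thetaTerm (q ^ 3) q p.2.1 * thetaTerm (q ^ 3) q p.2.2) := by
  have hs := (summable_thetaTerm_cube hq hq0).norm
  rw [← tsum_mul_tsum_of_summable_norm hs (summable_mul_of_summable_norm hs hs).norm,
    ← tsum_mul_tsum_of_summable_norm hs hs, tsum_thetaTerm_cube hq hq0]
  ring

/-- The dissection of Jacobi's identity along the exponents divisible by `3`. -/
theorem tsum_triple_filter_eq {q : ℂ} (hq : ‖q‖ < 1) (hq0 : q ≠ 0) :
    (∑' p : ℤ × ℤ × ℤ, if (p.1 + p.2.1 + p.2.2) % 3 = 0 then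
      thetaTerm (q ^ 3) q p.1 * (thetaTerm (q ^ 3) q p.2.1 * thetaTerm (q ^ 3) q p.2.2) else 0) =
    -∑' j : ℤ, if (j * (j - 1) / 2) % 3 = 0 then (j : ℂ) * thetaTerm q 1 j else 0 := by
  obtain ⟨w, hw3, hw⟩ := exists_primitive_cube_root
  have hJ : Summable fun j : ℤ => (j : ℂ) * thetaTerm q 1 j := by
    simpa using summable_pow_mul_thetaTerm hq hq0 one_ne_zero 1
  -- Replacing `q` by `v q` leaves `q^3` fixed, so equating the two expansions of `E(vq)^3` twists
  -- the terms only by powers of `v`. Averaging over the three cube roots of unity then selects the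
  -- exponents divisible by 3.
  have key (v : ℂ) (hv3 : v ^ 3 = 1) :
      ∑' p : ℤ × ℤ × ℤ, v ^ (p.1 + p.2.1 + p.2.2) * (thetaTerm (q ^ 3) q p.1 *
        (thetaTerm (q ^ 3) q p.2.1 * thetaTerm (q ^ 3) q p.2.2)) =
      -∑' j : ℤ, v ^ (j * (j - 1) / 2) * ((j : ℂ) * thetaTerm q 1 j) := by
    have hvn : ‖v‖ = 1 := Complex.norm_eq_one_of_pow_eq_one hv3 (by norm_num)
    have hv0 : v ≠ 0 := by rintro rfl; norm_num at hv3
    have h1 : ‖v * q‖ < 1 := by rwa [norm_mul, hvn, one_mul]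
    have h2 : v * q ≠ 0 := mul_ne_zero hv0 hq0
    have h := (eulerProduct_pow_three_eq_triple h1 h2).symm.trans (eulerProduct_pow_three h1 h2)
    rw [mul_pow, hv3, one_mul] at h
    simp_rw [thetaTerm_mul_right, thetaTerm_mul_left] at h
    convert h using 2
    · refine funext fun p => ?_
      rw [zpow_add₀ hv0, zpow_add₀ hv0]
      ring
    · refine tsum_congr fun j => ?_
      ring
  have h0 := key 1 (by norm_num)
  have h1 := key w hw3
  have h2 := key (w ^ 2) (by rw [← pow_mul, mul_comm, pow_mul, hw3, one_pow])
  simp only [one_zpow, one_mul] at h0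
  have hL := tsum_filter_three (summable_thetaTerm_triple hq hq0)
    (fun p => p.1 + p.2.1 + p.2.2) hw3 hw
  have hR := tsum_filter_three hJ (fun j => j * (j - 1) / 2) hw3 hw
  rw [h0, h1, h2] at hL
  linear_combination -(1 / 3 : ℂ) * hL - (1 / 3 : ℂ) * hR

/-- Triples with sum divisible by 3 are exactly `(n+x, n+y, n-x-y)`, with `n` a third of the sum. In
these coordinates the summand separates into a function of `n` times a function of `(x, y)`. -/
theorem tsum_triple_filter_eq_mul_cubicTheta {q : ℂ} (hq : ‖q‖ < 1) (hq0 : q ≠ 0) :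
    (∑' p : ℤ × ℤ × ℤ, if (p.1 + p.2.1 + p.2.2) % 3 = 0 then
      thetaTerm (q ^ 3) q p.1 * (thetaTerm (q ^ 3) q p.2.1 * thetaTerm (q ^ 3) q p.2.2) else 0) =
    eulerProduct (q ^ 3) * cubicTheta (q ^ 3) := by
  have h3 := norm_cube_lt_one hq
  have hq3 := pow_ne_zero 3 hq0
  have hinj : Function.Injective fun p : ℤ × ℤ × ℤ =>
      (p.1 + p.2.1, p.1 + p.2.2, p.1 - p.2.1 - p.2.2) := by
    rintro ⟨n, x, y⟩ ⟨n', x', y'⟩ h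
    simp only [Prod.mk.injEq] at h ⊢
    omega
  rw [← hinj.tsum_eq]
  · rw [cubicTheta, ← tsum_thetaTerm_cube h3 hq3,
      tsum_mul_tsum_of_summable_norm (summable_thetaTerm_cube h3 hq3).norm
        (summable_cubicThetaTerm h3).norm]
    refine tsum_congr fun p => ?_
    rw [if_pos (by dsimp only; omega)]
    exact thetaTerm_cube_mul_mul hq0 _ _ _
  · rintro ⟨a, b, c⟩ h
    have h' : (a + b + c) % 3 = 0 := by
      by_contra hc
      exact h (if_neg hc)
    refine ⟨((a + b + c) / 3, a - (a + b + c) / 3, b - (a + b + c) / 3), ?_⟩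
    simp only [Prod.mk.injEq]
    omega

/-- The number `j(j-1)/2` is divisible by 3 exactly for `j ≡ 0, 1` mod 3. Pairing `j = 3m` with `j =
1 - 3m`, whose theta terms are opposite, gives the weight `3m - (1 - 3m) = 6m - 1`. -/
theorem tsum_filter_thetaTerm_one {q : ℂ} (hq : ‖q‖ < 1) (hq0 : q ≠ 0) :
    (∑' j : ℤ, if (j * (j - 1) / 2) % 3 = 0 then (j : ℂ) * thetaTerm q 1 j else 0) =
      6 * (∑' m : ℤ, (m : ℂ) * thetaTerm ((q ^ 3) ^ 3) (q ^ 3) m) -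
        ∑' m : ℤ, thetaTerm ((q ^ 3) ^ 3) (q ^ 3) m := by
  have h3 := norm_cube_lt_one hq
  have hq3 := pow_ne_zero 3 hq0
  have hJ : Summable fun j : ℤ => (j : ℂ) * thetaTerm q 1 j := by
    simpa using summable_pow_mul_thetaTerm hq hq0 one_ne_zero 1
  have hs1 : Summable fun m : ℤ => (m : ℂ) * thetaTerm ((q ^ 3) ^ 3) (q ^ 3) m := by
    simpa using summable_pow_mul_thetaTerm (norm_cube_lt_one h3) (pow_ne_zero 3 hq3) hq3 1
  have hs0 := summable_thetaTerm_cube h3 hq3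
  have hi0 : Function.Injective fun m : ℤ => 3 * m := fun a b h => by simpa using h
  have hi1 : Function.Injective fun m : ℤ => 1 - 3 * m := fun a b h => by simpa using h
  have hS0 : Function.support (fun j : ℤ => if j % 3 = 0 then (j : ℂ) * thetaTerm q 1 j else 0) ⊆
      Set.range fun m : ℤ => 3 * m := fun j hj => by
    have : j % 3 = 0 := by
      by_contra hc
      exact hj (if_neg hc)
    exact ⟨j / 3, by dsimp only; omega⟩
  have hS1 : Function.support (fun j : ℤ => if j % 3 = 1 then (j : ℂ) * thetaTerm q 1 j else 0) ⊆
      Set.range fun m : ℤ => 1 - 3 * m := fun j hj => by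
    have : j % 3 = 1 := by
      by_contra hc
      exact hj (if_neg hc)
    exact ⟨-(j / 3), by dsimp only; omega⟩
  have hsplit (j : ℤ) : (if (j * (j - 1) / 2) % 3 = 0 then (j : ℂ) * thetaTerm q 1 j else 0) =
      (if j % 3 = 0 then (j : ℂ) * thetaTerm q 1 j else 0) +
      (if j % 3 = 1 then (j : ℂ) * thetaTerm q 1 j else 0) := by
    have h2 := two_mul_mul_pred_ediv_two j
    have h := Int.mul_ediv_add_emod j 3
    have hr : j % 3 = 0 ∨ j % 3 = 1 ∨ j % 3 = 2 := by omega
    generalize j * (j - 1) / 2 = e at *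
    generalize j / 3 = m at *
    rcases hr with hr | hr | hr <;> rw [hr] at h ⊢ <;> subst h
    · have : e % 3 = 0 := by ring_nf at h2; omega
      simp [this]
    · have : e % 3 = 0 := by ring_nf at h2; omega
      simp [this]
    · have : ¬ e % 3 = 0 := by ring_nf at h2; omega
      simp [this]
  have hsum (r : ℤ) : Summable fun j : ℤ => if j % 3 = r then (j : ℂ) * thetaTerm q 1 j else 0 :=
    (hJ.indicator {j | j % 3 = r}).congr fun j => by simp [Set.indicator_apply]
  rw [tsum_congr hsplit, (hsum 0).tsum_add (hsum 1), ← hi0.tsum_eq hS0, ← hi1.tsum_eq hS1,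
    ← tsum_mul_left, ← (hs1.mul_left 6).tsum_sub hs0, ← Summable.tsum_add]
  · refine tsum_congr fun m => ?_
    rw [if_pos (by omega), if_pos (by omega), thetaTerm_one_sub, thetaTerm_one_three_mul hq0]
    push_cast
    ring
  · exact (hsum 0).comp_injective hi0
  · exact (hsum 1).comp_injective hi1

/-- The Lambert series of the cubic theta function. -/
theorem cubicTheta_eq_lambert {q : ℂ} (hq : ‖q‖ < 1) :
    cubicTheta q = 1 + 6 * ∑' n : ℕ, chiThree n * lambertTerm q n := by
  rcases eq_or_ne q 0 with rfl | hq0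
  · have h1 : cubicTheta 0 = 1 := by
      rw [cubicTheta, tsum_eq_single (0, 0)]
      · simp [cubicThetaTerm]
      · rintro ⟨x, y⟩ h
        refine zero_zpow _ fun h0 => h ?_
        have hx : x = 0 := by dsimp only at h0; nlinarith [sq_nonneg (x + 2 * y), sq_nonneg x]
        have hy : y = 0 := by dsimp only at h0; nlinarith [sq_nonneg (2 * x + y), sq_nonneg y]
        rw [hx, hy]
    have h2 (n : ℕ) : chiThree n * lambertTerm 0 n = 0 := by
      rcases n with _ | n <;> simp [lambertTerm]
    simp [h1, h2]
  -- The dissection yields `a` only at a cube, so it is applied to a cube root of `q`.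
  · obtain ⟨Q, hQ⟩ := IsAlgClosed.exists_pow_nat_eq q (n := 3) (by norm_num)
    have hQ1 : ‖Q‖ < 1 := by
      rw [← hQ, norm_pow] at hq
      exact (pow_lt_one_iff_of_nonneg (norm_nonneg _) (by norm_num)).mp hq
    have hQ0 : Q ≠ 0 := by
      rintro rfl
      exact hq0 (by rw [← hQ]; norm_num)
    have h1 := tsum_triple_filter_eq hQ1 hQ0
    rw [tsum_triple_filter_eq_mul_cubicTheta hQ1 hQ0, tsum_filter_thetaTerm_one hQ1 hQ0, hQ,
      tsum_mul_thetaTerm_cube hq hq0, tsum_thetaTerm_cube hq hq0] at h1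
    refine mul_left_cancel₀ (eulerProduct_ne_zero hq) ?_
    linear_combination h1

/-! ### Products of Lambert terms and manipulation of double series. -/

/-- The cosine `cos (2 π n / 3)`. -/
noncomputable def cosThree (n : ℕ) : ℂ := if n % 3 = 0 then 1 else -1 / 2

theorem norm_cosThree_le (n : ℕ) : ‖cosThree n‖ ≤ 1 := by
  unfold cosThree
  split_ifs <;> norm_num

/-- The partial-fraction identity for `x/(1-x) · y/(1-y)` that drives both squarings: it trades a
product of Lambert terms for terms involving the index sum. -/
theorem lambertTerm_mul {q : ℂ} (hq : ‖q‖ < 1) (m k : ℕ+) :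
    lambertTerm q m * lambertTerm q k =
      lambertTerm q (m + k) * (1 + lambertTerm q m + lambertTerm q k) := by
  obtain ⟨a, ha⟩ := Nat.exists_eq_succ_of_ne_zero m.ne_zero
  obtain ⟨b, hb⟩ := Nat.exists_eq_succ_of_ne_zero k.ne_zero
  have h1 := one_sub_pow_succ_ne_zero hq a
  have h2 := one_sub_pow_succ_ne_zero hq b
  have h3 := one_sub_pow_succ_ne_zero hq (a + (b + 1))
  rw [ha, hb]
  simp only [lambertTerm, Nat.succ_eq_add_one]
  rw [show a + (b + 1) + 1 = (a + 1) + (b + 1) by ring] at h3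
  rw [pow_add] at h3
  simp only [pow_add q (a + 1) (b + 1)]
  generalize q ^ (a + 1) = x at *
  generalize q ^ (b + 1) = y at *
  field_simp
  ring

theorem lambertTerm_mul_add {q : ℂ} (hq : ‖q‖ < 1) (m k : ℕ+) :
    lambertTerm q m * lambertTerm q (m + k) = lambertTerm q k * lambertTerm q m -
      lambertTerm q k * lambertTerm q (m + k) - lambertTerm q (m + k) := by
  linear_combination -lambertTerm_mul hq m k

theorem norm_lambertTerm_le {q : ℂ} (hq : ‖q‖ < 1) {n : ℕ} (hn : n ≠ 0) :
    ‖lambertTerm q n‖ ≤ (1 - ‖q‖)⁻¹ * ‖q‖ ^ n := by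
  have h1 : ‖q‖ ^ n ≤ ‖q‖ := pow_le_of_le_one (norm_nonneg q) hq.le hn
  have h2 : 1 - ‖q‖ ≤ ‖1 - q ^ n‖ := by
    have := norm_sub_norm_le (1 : ℂ) (q ^ n)
    rw [norm_one, norm_pow] at this
    linarith
  rw [lambertTerm, norm_div, norm_pow, div_eq_inv_mul]
  have : 0 < 1 - ‖q‖ := by linarith
  gcongr

/-- A family on `ℕ+ × ℕ+` dominated by a product of geometric sequences of ratio `‖q‖`. -/
def GeometricallyBounded (q : ℂ) (v : ℕ+ × ℕ+ → ℂ) : Prop :=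
  ∃ K : ℝ, 0 ≤ K ∧ ∀ p, ‖v p‖ ≤ K * (‖q‖ ^ (p.1 : ℕ) * ‖q‖ ^ (p.2 : ℕ))

theorem GeometricallyBounded.summable_mul {q : ℂ} (hq : ‖q‖ < 1) {v : ℕ+ × ℕ+ → ℂ}
    (hv : GeometricallyBounded q v) {a : ℕ+ × ℕ+ → ℂ} {B : ℝ}
    (ha : ∀ p, ‖a p‖ ≤ B * ((p.1 : ℝ) ^ 2 * (p.2 : ℝ) ^ 2)) : Summable fun p => a p * v p := by
  obtain ⟨K, hK, hv⟩ := hv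
  have hs : Summable fun n : ℕ+ => (n : ℝ) ^ 2 * ‖q‖ ^ (n : ℕ) :=
    (summable_pow_mul_geometric_of_norm_lt_one (R := ℝ) 2 (r := ‖q‖) (by simpa using hq)).comp_injective
      PNat.coe_injective
  refine Summable.of_norm_bounded ((hs.mul_of_nonneg hs (fun _ => by positivity)
    fun _ => by positivity).mul_left (B * K)) fun p => ?_
  rw [norm_mul]
  calc ‖a p‖ * ‖v p‖ ≤ (B * ((p.1 : ℝ) ^ 2 * (p.2 : ℝ) ^ 2)) *
        (K * (‖q‖ ^ (p.1 : ℕ) * ‖q‖ ^ (p.2 : ℕ))) :=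
        mul_le_mul (ha p) (hv p) (norm_nonneg _) ((norm_nonneg _).trans (ha p))
    _ = _ := by ring

theorem geometricallyBounded_add {q : ℂ} (hq : ‖q‖ < 1) :
    GeometricallyBounded q fun p => lambertTerm q (p.1 + p.2) := by
  refine ⟨(1 - ‖q‖)⁻¹, inv_nonneg.mpr (by linarith), fun p => ?_⟩
  rw [← pow_add]
  exact norm_lambertTerm_le hq (by simp)

theorem geometricallyBounded_mul {q : ℂ} (hq : ‖q‖ < 1) :
    GeometricallyBounded q fun p => lambertTerm q p.1 * lambertTerm q p.2 := by
  have h0 : 0 ≤ (1 - ‖q‖)⁻¹ := inv_nonneg.mpr (by linarith)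
  refine ⟨(1 - ‖q‖)⁻¹ * (1 - ‖q‖)⁻¹, by positivity, fun p => ?_⟩
  rw [norm_mul, mul_mul_mul_comm]
  exact mul_le_mul (norm_lambertTerm_le hq p.1.ne_zero) (norm_lambertTerm_le hq p.2.ne_zero)
    (norm_nonneg _) (by positivity)

theorem norm_lambertTerm_le_const {q : ℂ} (hq : ‖q‖ < 1) {n : ℕ} (hn : n ≠ 0) :
    ‖lambertTerm q n‖ ≤ (1 - ‖q‖)⁻¹ :=
  (norm_lambertTerm_le hq hn).trans (mul_le_of_le_one_right (inv_nonneg.mpr (by linarith))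
    (pow_le_one₀ (norm_nonneg _) hq.le))

theorem GeometricallyBounded.lambertTerm_mul {q : ℂ} (hq : ‖q‖ < 1) {v : ℕ+ × ℕ+ → ℂ}
    (hv : GeometricallyBounded q v) (f : ℕ+ × ℕ+ → ℕ+) :
    GeometricallyBounded q fun p => lambertTerm q (f p) * v p := by
  obtain ⟨K, hK, hv⟩ := hv
  have h0 : 0 ≤ (1 - ‖q‖)⁻¹ := inv_nonneg.mpr (by linarith)
  refine ⟨(1 - ‖q‖)⁻¹ * K, by positivity, fun p => ?_⟩
  rw [norm_mul, mul_assoc]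
  exact mul_le_mul (norm_lambertTerm_le_const hq (f p).ne_zero) (hv p) (norm_nonneg _) h0

/-- Splitting a double sum along the diagonal. -/
theorem tsum_pnat_prod_split {g : ℕ+ × ℕ+ → ℂ} (hg : Summable g) :
    ∑' p, g p = (∑' m, g (m, m)) + (∑' p : ℕ+ × ℕ+, g (p.1, p.1 + p.2)) +
      ∑' p : ℕ+ × ℕ+, g (p.1 + p.2, p.1) := by
  have hd : Function.Injective fun m : ℕ+ => (m, m) := fun a b h => (Prod.mk.inj h).1
  have hl : Function.Injective fun p : ℕ+ × ℕ+ => (p.1, p.1 + p.2) := by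
    rintro ⟨a, b⟩ ⟨c, d⟩ h
    simp only [Prod.mk.injEq] at h ⊢
    obtain ⟨rfl, h⟩ := h
    exact ⟨rfl, add_left_cancel h⟩
  have hr : Function.Injective fun p : ℕ+ × ℕ+ => (p.1 + p.2, p.1) := by
    rintro ⟨a, b⟩ ⟨c, d⟩ h
    simp only [Prod.mk.injEq] at h ⊢
    obtain ⟨h, rfl⟩ := h
    exact ⟨rfl, add_left_cancel h⟩
  have hsplit (p : ℕ+ × ℕ+) : g p = (if p.1 = p.2 then g p else 0) +
      (if p.1 < p.2 then g p else 0) + if p.2 < p.1 then g p else 0 := by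
    rcases lt_trichotomy p.1 p.2 with h | h | h
    · simp [h, h.ne, h.le.not_gt]
    · simp [h]
    · simp [h, h.ne', h.le.not_gt]
  have hsum (s : ℕ+ × ℕ+ → Prop) [DecidablePred s] : Summable fun p => if s p then g p else 0 :=
    (hg.indicator {p | s p}).congr fun p => by simp [Set.indicator_apply]
  have hsupp (s : ℕ+ × ℕ+ → Prop) [DecidablePred s] (p : ℕ+ × ℕ+)
      (hp : p ∈ Function.support fun p => if s p then g p else 0) : s p := by
    by_contra hc
    exact hp (if_neg hc)
  have e1 : (∑' p : ℕ+ × ℕ+, if p.1 = p.2 then g p else 0) = ∑' m, g (m, m) := by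
    rw [← hd.tsum_eq]
    · simp
    · rintro ⟨a, b⟩ hp
      exact ⟨a, by simpa using hsupp (fun p => p.1 = p.2) _ hp⟩
  have e2 : (∑' p : ℕ+ × ℕ+, if p.1 < p.2 then g p else 0) =
      ∑' p : ℕ+ × ℕ+, g (p.1, p.1 + p.2) := by
    rw [← hl.tsum_eq]
    · exact tsum_congr fun p => if_pos (PNat.lt_add_right _ _)
    · rintro ⟨a, b⟩ hp
      have h := hsupp (fun p => p.1 < p.2) _ hp
      exact ⟨(a, b - a), by simp [PNat.add_sub_of_lt h]⟩
  have e3 : (∑' p : ℕ+ × ℕ+, if p.2 < p.1 then g p else 0) =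
      ∑' p : ℕ+ × ℕ+, g (p.1 + p.2, p.1) := by
    rw [← hr.tsum_eq]
    · exact tsum_congr fun p => if_pos (PNat.lt_add_right _ _)
    · rintro ⟨a, b⟩ hp
      have h := hsupp (fun p => p.2 < p.1) _ hp
      exact ⟨(b, a - b), by simp [PNat.add_sub_of_lt h]⟩
  rw [tsum_congr hsplit, ((hsum _).add (hsum _)).tsum_add (hsum _), (hsum _).tsum_add (hsum _),
    e1, e2, e3]

theorem tsum_pnat_prod_swap (g : ℕ+ × ℕ+ → ℂ) : ∑' p : ℕ+ × ℕ+, g (p.2, p.1) = ∑' p, g p :=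
  (Equiv.prodComm ℕ+ ℕ+).tsum_eq g

/-- Grouping a double sum by the value of the sum of the indices. -/
theorem tsum_pnat_prod_group {F : ℕ → ℕ → ℂ} (hF : Summable fun p : ℕ+ × ℕ+ => F p.1 p.2) :
    ∑' p : ℕ+ × ℕ+, F p.1 p.2 = ∑' N : ℕ+, ∑ k ∈ Finset.Ico 1 (N : ℕ), F (N - k) k := by
  let e : ℕ × ℕ ≃ ℕ+ × ℕ+ := Equiv.prodCongr Equiv.pnatEquivNat.symm Equiv.pnatEquivNat.symm
  have he (p : ℕ × ℕ) : F (e p).1 (e p).2 = F (p.1 + 1) (p.2 + 1) := by simp [e]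
  have hF' : Summable fun p : ℕ × ℕ => F (p.1 + 1) (p.2 + 1) :=
    (e.summable_iff.mpr hF).congr he
  have hfin (n : ℕ) : ∑' y : Finset.HasAntidiagonal.antidiagonal n, F (y.1.1 + 1) (y.1.2 + 1) =
      ∑ k ∈ Finset.Ico 1 (n + 1 + 1), F (n + 1 + 1 - k) k := by
    rw [Finset.tsum_subtype (Finset.HasAntidiagonal.antidiagonal n) fun p : ℕ × ℕ => F (p.1 + 1) (p.2 + 1),
      ← Finset.Nat.sum_antidiagonal_swap, Finset.Nat.sum_antidiagonal_eq_sum_range_succ_mk,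
      Finset.sum_Ico_eq_sum_range]
    refine Finset.sum_congr rfl fun k hk => ?_
    have : k ≤ n := Nat.lt_succ_iff.mp (Finset.mem_range.mp hk)
    simp only [Prod.fst_swap, Prod.snd_swap]
    congr 1 <;> omega
  have hσ : Summable fun x : (n : ℕ) × Finset.HasAntidiagonal.antidiagonal n =>
      F (x.2.1.1 + 1) (x.2.1.2 + 1) :=
    Finset.HasAntidiagonal.sigmaAntidiagonalEquivProd.summable_iff.mpr hF'
  have hS' : Summable fun n : ℕ => ∑ k ∈ Finset.Ico 1 (n + 1 + 1), F (n + 1 + 1 - k) k :=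
    hσ.sigma.congr fun n => hfin n
  -- Two positive indices have sum at least 2, so the antidiagonals begin at `N = 2`; the term `N =
  -- 1` is an empty sum.
  rw [← e.tsum_eq, tsum_congr he, ← Finset.HasAntidiagonal.sigmaAntidiagonalEquivProd.tsum_eq,
    show (∑' c, F ((Finset.HasAntidiagonal.sigmaAntidiagonalEquivProd c).1 + 1)
      ((Finset.HasAntidiagonal.sigmaAntidiagonalEquivProd c).2 + 1)) = _ from hσ.tsum_sigma,
    tsum_pnat_eq_tsum_succ (f := fun N : ℕ => ∑ k ∈ Finset.Ico 1 N, F (N - k) k),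
    ((summable_nat_add_iff
      (f := fun n : ℕ => ∑ k ∈ Finset.Ico 1 (n + 1), F (n + 1 - k) k) 1).mp hS').tsum_eq_zero_add]
  simp only [zero_add, Finset.Ico_self, Finset.sum_empty]
  exact tsum_congr hfin

/-- Product-to-sum formula for sines, since `χ(n) = (2/√3) sin(2πn/3)`. -/
theorem chiThree_mul_chiThree_add (m k : ℕ) :
    chiThree m * chiThree (m + k) = 2 / 3 * (cosThree k - cosThree (2 * m + k)) := by
  have hm : m % 3 = 0 ∨ m % 3 = 1 ∨ m % 3 = 2 := by omega
  have hk : k % 3 = 0 ∨ k % 3 = 1 ∨ k % 3 = 2 := by omega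
  rcases hm with h | h | h <;> rcases hk with h' | h' | h' <;>
    norm_num [chiThree, cosThree, Nat.add_mod, Nat.mul_mod, h, h']

theorem cosThree_mul_cosThree_add (m k : ℕ) :
    cosThree m * cosThree (m + k) = (cosThree (2 * m + k) + cosThree k) / 2 := by
  have hm : m % 3 = 0 ∨ m % 3 = 1 ∨ m % 3 = 2 := by omega
  have hk : k % 3 = 0 ∨ k % 3 = 1 ∨ k % 3 = 2 := by omega
  rcases hm with h | h | h <;> rcases hk with h' | h' | h' <;>
    norm_num [cosThree, Nat.add_mod, Nat.mul_mod, h, h']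

theorem GeometricallyBounded.summable_weight {q : ℂ} (hq : ‖q‖ < 1) {v : ℕ+ × ℕ+ → ℂ}
    (hv : GeometricallyBounded q v) {x c : ℕ+ × ℕ+ → ℂ} (hc : ∀ p, ‖c p‖ ≤ 1)
    (hx : ∀ p, ‖x p‖ ≤ 2 * ((p.1 : ℝ) ^ 2 * (p.2 : ℝ) ^ 2)) :
    Summable fun p => x p * c p * v p :=
  hv.summable_mul hq fun p => by
    rw [norm_mul]
    exact (mul_le_of_le_one_right (norm_nonneg _) (hc p)).trans (hx p)

theorem GeometricallyBounded.summable_bounded {q : ℂ} (hq : ‖q‖ < 1) {v : ℕ+ × ℕ+ → ℂ}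
    (hv : GeometricallyBounded q v) {c : ℕ+ × ℕ+ → ℂ} (hc : ∀ p, ‖c p‖ ≤ 1) :
    Summable fun p => c p * v p :=
  hv.summable_mul hq (B := 1) fun p => (hc p).trans <| by
    have h1 : (1 : ℝ) ≤ p.1 := by exact_mod_cast one_le (a := p.1)
    have h2 : (1 : ℝ) ≤ p.2 := by exact_mod_cast one_le (a := p.2)
    rw [one_mul]
    exact one_le_mul_of_one_le_of_one_le (one_le_pow₀ h1) (one_le_pow₀ h2)

theorem weight_bounds (p : ℕ+ × ℕ+) :
    ‖((p.1 : ℕ) : ℂ) * ((p.2 : ℕ) : ℂ)‖ ≤ 2 * ((p.1 : ℝ) ^ 2 * (p.2 : ℝ) ^ 2) ∧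
    ‖((p.1 : ℕ) : ℂ) * (((p.1 : ℕ) : ℂ) + ((p.2 : ℕ) : ℂ))‖ ≤ 2 * ((p.1 : ℝ) ^ 2 * (p.2 : ℝ) ^ 2) ∧
    ‖((p.1 : ℕ) : ℂ) * (((p.1 : ℕ) : ℂ) - ((p.2 : ℕ) : ℂ))‖ ≤ 2 * ((p.1 : ℝ) ^ 2 * (p.2 : ℝ) ^ 2) := by
  have h1 : (1 : ℝ) ≤ p.1 := by exact_mod_cast one_le (a := p.1)
  have h2 : (1 : ℝ) ≤ p.2 := by exact_mod_cast one_le (a := p.2)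
  have e : ‖((p.1 : ℕ) : ℂ)‖ = (p.1 : ℝ) := by simp
  have f : ‖((p.2 : ℕ) : ℂ)‖ = (p.2 : ℝ) := by simp
  have ha := norm_add_le ((p.1 : ℕ) : ℂ) ((p.2 : ℕ) : ℂ)
  have hs := norm_sub_le ((p.1 : ℕ) : ℂ) ((p.2 : ℕ) : ℂ)
  rw [norm_mul, norm_mul, norm_mul]
  rw [e, f] at *
  generalize ((p.1 : ℕ) : ℝ) = a at *
  generalize ((p.2 : ℕ) : ℝ) = b at *
  have hab : 1 ≤ a * b := one_le_mul_of_one_le_of_one_le h1 h2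
  have hsum : a + b ≤ 2 * (a * b) := by nlinarith
  have hsq : a * (2 * (a * b)) ≤ 2 * (a ^ 2 * b ^ 2) := by
    have : a ^ 2 * b * 1 ≤ a ^ 2 * b * b := mul_le_mul_of_nonneg_left h2 (by positivity)
    nlinarith
  have h0 : 0 ≤ a := by linarith
  refine ⟨by nlinarith, ?_, ?_⟩
  · exact (mul_le_mul_of_nonneg_left (ha.trans hsum) h0).trans hsq
  · exact (mul_le_mul_of_nonneg_left (hs.trans hsum) h0).trans hsq

theorem summable_pnat_mul_lambertTerm {q : ℂ} (hq : ‖q‖ < 1) {c : ℕ → ℂ} {K : ℝ} {k : ℕ}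
    (hc : ∀ n, ‖c n‖ ≤ K * n ^ k) : Summable fun n : ℕ+ => c n * lambertTerm q n :=
  (summable_mul_lambertTerm hq hc).comp_injective PNat.coe_injective

theorem summable_pnat_mul_lambertTerm_mul_self {q : ℂ} (hq : ‖q‖ < 1) {c : ℕ → ℂ} {K : ℝ} {k : ℕ}
    (hc : ∀ n, ‖c n‖ ≤ K * n ^ k) :
    Summable fun n : ℕ+ => c n * (lambertTerm q n * lambertTerm q n) := by
  refine Summable.of_norm_bounded
    ((summable_pnat_mul_lambertTerm hq hc).norm.mul_right (1 - ‖q‖)⁻¹) fun n => ?_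
  rw [← mul_assoc, norm_mul]
  exact mul_le_mul_of_nonneg_left (norm_lambertTerm_le_const hq n.ne_zero) (norm_nonneg _)

/-! ### Squares of Lambert series. -/

/-- The square of the Lambert series of the character modulo `3`. -/
theorem tsum_chiThree_mul_self {q : ℂ} (hq : ‖q‖ < 1) :
    (∑' n : ℕ+, chiThree n * lambertTerm q n) * (∑' n : ℕ+, chiThree n * lambertTerm q n) =
      2 / 3 * ((∑' n : ℕ+, (1 + 2 * cosThree n) * (lambertTerm q n * lambertTerm q n)) -
        2 * (∑' p : ℕ+ × ℕ+, cosThree p.2 * lambertTerm q (p.1 + p.2)) -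
        ∑' p : ℕ+ × ℕ+, cosThree (p.1 + p.2) * lambertTerm q (p.1 + p.2)) := by
  have ba := geometricallyBounded_add hq
  have bm := geometricallyBounded_mul hq
  have b1 := ba.lambertTerm_mul hq Prod.fst
  have b2 := ba.lambertTerm_mul hq Prod.snd
  have hc := norm_cosThree_le
  have hχ := norm_chiThree_le
  have hc' (n : ℕ) : ‖cosThree n‖ ≤ 1 * (n : ℝ) ^ 0 := by simpa using hc n
  have hχ' (n : ℕ) : ‖chiThree n‖ ≤ 1 * (n : ℝ) ^ 0 := by simpa using hχ n
  have hL := summable_pnat_mul_lambertTerm hq hχ'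
  have hXs : Summable fun p : ℕ+ × ℕ+ =>
      cosThree p.2 * (lambertTerm q p.1 * lambertTerm q p.2) := bm.summable_bounded hq fun _ => hc _
  have hYs : Summable fun p : ℕ+ × ℕ+ =>
      cosThree p.2 * (lambertTerm q p.2 * lambertTerm q (p.1 + p.2)) :=
    b2.summable_bounded hq fun _ => hc _
  have hVs : Summable fun p : ℕ+ × ℕ+ => cosThree p.2 * lambertTerm q (p.1 + p.2) :=
    ba.summable_bounded hq fun _ => hc _
  have hWs : Summable fun p : ℕ+ × ℕ+ =>
      cosThree p.2 * (lambertTerm q p.1 * lambertTerm q (p.1 + p.2)) :=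
    b1.summable_bounded hq fun _ => hc _
  have hX1s : Summable fun p : ℕ+ × ℕ+ =>
      cosThree (p.1 + p.2) * (lambertTerm q p.1 * lambertTerm q p.2) :=
    bm.summable_bounded hq fun _ => hc _
  have hOcs : Summable fun p : ℕ+ × ℕ+ =>
      cosThree (2 * p.1 + p.2) * (lambertTerm q p.1 * lambertTerm q (p.1 + p.2)) :=
    b1.summable_bounded hq fun _ => hc _
  have hV1s : Summable fun p : ℕ+ × ℕ+ => cosThree (p.1 + p.2) * lambertTerm q (p.1 + p.2) :=
    ba.summable_bounded hq fun _ => hc _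
  have hZs : Summable fun p : ℕ+ × ℕ+ =>
      cosThree (p.1 + p.2) * (lambertTerm q p.1 * lambertTerm q (p.1 + p.2)) :=
    b1.summable_bounded hq fun _ => hc _
  have hZs' : Summable fun p : ℕ+ × ℕ+ =>
      cosThree (p.1 + p.2) * (lambertTerm q p.2 * lambertTerm q (p.1 + p.2)) :=
    b2.summable_bounded hq fun _ => hc _
  have hLs : Summable fun p : ℕ+ × ℕ+ =>
      (chiThree p.1 * lambertTerm q p.1) * (chiThree p.2 * lambertTerm q p.2) :=
    summable_mul_of_summable_norm (f := fun n : ℕ+ => chiThree n * lambertTerm q n)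
      (g := fun n : ℕ+ => chiThree n * lambertTerm q n) hL.norm hL.norm
  have hDs : Summable fun n : ℕ+ => lambertTerm q n * lambertTerm q n := by
    simpa using summable_pnat_mul_lambertTerm_mul_self hq (c := fun _ => 1) (K := 1) (k := 0)
      (by simp)
  have hDcs := summable_pnat_mul_lambertTerm_mul_self hq hc'
  have hDc2s := summable_pnat_mul_lambertTerm_mul_self hq (c := fun n => cosThree (2 * n))
    (K := 1) (k := 0) fun n => by simpa using hc (2 * n)
  have eL : (∑' n : ℕ+, chiThree n * lambertTerm q n) *
      (∑' n : ℕ+, chiThree n * lambertTerm q n) =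
      2 / 3 * ((∑' n : ℕ+, lambertTerm q n * lambertTerm q n) -
        ∑' n : ℕ+, cosThree (2 * n) * (lambertTerm q n * lambertTerm q n)) +
      2 * (2 / 3 * ((∑' p : ℕ+ × ℕ+,
        cosThree p.2 * (lambertTerm q p.1 * lambertTerm q (p.1 + p.2))) -
        ∑' p : ℕ+ × ℕ+,
          cosThree (2 * p.1 + p.2) * (lambertTerm q p.1 * lambertTerm q (p.1 + p.2)))) := by
    rw [tsum_mul_tsum_of_summable_norm hL.norm hL.norm, tsum_pnat_prod_split hLs, two_mul,
      ← add_assoc, ← hDs.tsum_sub hDc2s, ← hWs.tsum_sub hOcs, ← tsum_mul_left, ← tsum_mul_left]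
    congr 1
    · congr 1
      · refine tsum_congr fun m => ?_
        have h := chiThree_mul_chiThree_add m 0
        have h0 : cosThree 0 = 1 := by simp [cosThree]
        rw [h0, add_zero, add_zero] at h
        linear_combination (lambertTerm q m * lambertTerm q m) * h
      · refine tsum_congr fun p => ?_
        simp only [PNat.add_coe]
        linear_combination (lambertTerm q p.1 * lambertTerm q (p.1 + p.2)) *
          chiThree_mul_chiThree_add p.1 p.2
    · refine tsum_congr fun p => ?_
      simp only [PNat.add_coe]
      linear_combination (lambertTerm q p.1 * lambertTerm q (p.1 + p.2)) *
        chiThree_mul_chiThree_add p.1 p.2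
  -- The same double sum is evaluated twice, by splitting along the diagonal here and by
  -- `lambertTerm_mul` in `eX1'`. Comparison eliminates the terms with `cosThree (2 * m + k)`.
  have eX1 : ∑' p : ℕ+ × ℕ+, cosThree (p.1 + p.2) * (lambertTerm q p.1 * lambertTerm q p.2) =
      (∑' n : ℕ+, cosThree (2 * n) * (lambertTerm q n * lambertTerm q n)) +
      2 * ∑' p : ℕ+ × ℕ+,
        cosThree (2 * p.1 + p.2) * (lambertTerm q p.1 * lambertTerm q (p.1 + p.2)) := by
    rw [tsum_pnat_prod_split hX1s, two_mul, ← add_assoc]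
    congr 1
    · congr 1
      · exact tsum_congr fun m => by rw [two_mul]
      · exact tsum_congr fun p => by rw [PNat.add_coe, ← add_assoc, ← two_mul]
    · refine tsum_congr fun p => ?_
      rw [PNat.add_coe, show (p.1 + p.2 + p.1 : ℕ) = 2 * p.1 + p.2 by ring]
      ring
  have eX1' : ∑' p : ℕ+ × ℕ+, cosThree (p.1 + p.2) * (lambertTerm q p.1 * lambertTerm q p.2) =
      (∑' p : ℕ+ × ℕ+, cosThree (p.1 + p.2) * lambertTerm q (p.1 + p.2)) +
      2 * ∑' p : ℕ+ × ℕ+,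
        cosThree (p.1 + p.2) * (lambertTerm q p.1 * lambertTerm q (p.1 + p.2)) := by
    have hsw : ∑' p : ℕ+ × ℕ+,
        cosThree (p.1 + p.2) * (lambertTerm q p.1 * lambertTerm q (p.1 + p.2)) =
        ∑' p : ℕ+ × ℕ+,
        cosThree (p.1 + p.2) * (lambertTerm q p.2 * lambertTerm q (p.1 + p.2)) := by
      rw [← tsum_pnat_prod_swap]
      exact tsum_congr fun p => by rw [add_comm (p.2 : ℕ)]
    rw [two_mul, ← add_assoc]
    nth_rewrite 2 [hsw]
    rw [← hV1s.tsum_add hZs, ← (hV1s.add hZs).tsum_add hZs']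
    refine tsum_congr fun p => ?_
    rw [lambertTerm_mul hq]
    ring
  have eW : ∑' p : ℕ+ × ℕ+, cosThree p.2 * (lambertTerm q p.1 * lambertTerm q (p.1 + p.2)) =
      (∑' p : ℕ+ × ℕ+, cosThree p.2 * (lambertTerm q p.1 * lambertTerm q p.2)) -
      (∑' p : ℕ+ × ℕ+, cosThree p.2 * (lambertTerm q p.2 * lambertTerm q (p.1 + p.2))) -
      ∑' p : ℕ+ × ℕ+, cosThree p.2 * lambertTerm q (p.1 + p.2) := by
    rw [← hXs.tsum_sub hYs, ← (hXs.sub hYs).tsum_sub hVs]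
    refine tsum_congr fun p => ?_
    rw [lambertTerm_mul_add hq]
    ring
  -- Splitting along the diagonal reproduces the sum subtracted in `eW`, which therefore cancels.
  have eX : ∑' p : ℕ+ × ℕ+, cosThree p.2 * (lambertTerm q p.1 * lambertTerm q p.2) =
      (∑' n : ℕ+, cosThree n * (lambertTerm q n * lambertTerm q n)) +
      (∑' p : ℕ+ × ℕ+,
        cosThree (p.1 + p.2) * (lambertTerm q p.1 * lambertTerm q (p.1 + p.2))) +
      ∑' p : ℕ+ × ℕ+, cosThree p.2 * (lambertTerm q p.2 * lambertTerm q (p.1 + p.2)) := by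
    rw [tsum_pnat_prod_split hXs]
    congr 1
    rw [← tsum_pnat_prod_swap fun p : ℕ+ × ℕ+ =>
      cosThree p.2 * (lambertTerm q p.2 * lambertTerm q (p.1 + p.2))]
    refine tsum_congr fun p => ?_
    rw [PNat.add_coe, add_comm (p.2 : ℕ), mul_comm (lambertTerm q p.1)]
  have eD : ∑' n : ℕ+, (1 + 2 * cosThree n) * (lambertTerm q n * lambertTerm q n) =
      (∑' n : ℕ+, lambertTerm q n * lambertTerm q n) +
      2 * ∑' n : ℕ+, cosThree n * (lambertTerm q n * lambertTerm q n) := by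
    rw [← tsum_mul_left, ← hDs.tsum_add (hDcs.mul_left 2)]
    exact tsum_congr fun n => by ring
  rw [eL, eD]
  linear_combination (4 / 3 : ℂ) * eW + (4 / 3 : ℂ) * eX + (2 / 3 : ℂ) * eX1 - (2 / 3 : ℂ) * eX1'

/-- The square of a weighted Lambert series whose coefficients satisfy the addition law of the
cosine. -/
theorem tsum_mul_lambertTerm_mul_self {q : ℂ} (hq : ‖q‖ < 1) {c : ℕ → ℂ} (hc : ∀ n, ‖c n‖ ≤ 1)
    (hc0 : c 0 = 1) (hadd : ∀ m k, c m * c (m + k) = (c (2 * m + k) + c k) / 2) :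
    (∑' n : ℕ+, (n : ℂ) * c n * lambertTerm q n) * (∑' n : ℕ+, (n : ℂ) * c n * lambertTerm q n) =
      2 * ((∑' n : ℕ+, (n : ℂ) * lambertTerm q n) * ∑' n : ℕ+, (n : ℂ) * c n * lambertTerm q n) +
      1 / 2 * (∑' n : ℕ+, (n : ℂ) ^ 2 * (lambertTerm q n * lambertTerm q n)) +
      1 / 2 * (∑' p : ℕ+ × ℕ+, (p.1 : ℂ) * p.2 * c (p.1 + p.2) * lambertTerm q (p.1 + p.2)) -
      ∑' p : ℕ+ × ℕ+, (p.1 : ℂ) * (p.1 + p.2) * c p.2 * lambertTerm q (p.1 + p.2) := by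
  have ba := geometricallyBounded_add hq
  have bm := geometricallyBounded_mul hq
  have b1 := ba.lambertTerm_mul hq Prod.fst
  have b2 := ba.lambertTerm_mul hq Prod.snd
  have w1 := fun p => (weight_bounds p).1
  have w2 := fun p => (weight_bounds p).2.1
  have w3 := fun p => (weight_bounds p).2.2
  have hC : Summable fun n : ℕ+ => (n : ℂ) * c n * lambertTerm q n :=
    summable_pnat_mul_lambertTerm hq (c := fun n => (n : ℂ) * c n) (K := 1) (k := 1) fun n => by
      rw [norm_mul]
      simpa using mul_le_of_le_one_right (norm_nonneg (n : ℂ)) (hc n)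
  have hS : Summable fun n : ℕ+ => (n : ℂ) * lambertTerm q n :=
    summable_pnat_mul_lambertTerm hq (c := fun n => (n : ℂ)) (K := 1) (k := 1) fun n => by simp
  have hXs : Summable fun p : ℕ+ × ℕ+ =>
      (p.1 : ℂ) * (p.1 + p.2) * c p.2 * (lambertTerm q p.1 * lambertTerm q p.2) :=
    bm.summable_weight hq (fun _ => hc _) w2
  have hGs : Summable fun p : ℕ+ × ℕ+ =>
      (p.1 : ℂ) * (p.1 - p.2) * c p.2 * (lambertTerm q p.1 * lambertTerm q p.2) :=
    bm.summable_weight hq (fun _ => hc _) w3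
  have hYs : Summable fun p : ℕ+ × ℕ+ =>
      (p.1 : ℂ) * (p.1 + p.2) * c p.2 * (lambertTerm q p.2 * lambertTerm q (p.1 + p.2)) :=
    b2.summable_weight hq (fun _ => hc _) w2
  have hVs : Summable fun p : ℕ+ × ℕ+ =>
      (p.1 : ℂ) * (p.1 + p.2) * c p.2 * lambertTerm q (p.1 + p.2) :=
    ba.summable_weight hq (fun _ => hc _) w2
  have hWs : Summable fun p : ℕ+ × ℕ+ =>
      (p.1 : ℂ) * (p.1 + p.2) * c p.2 * (lambertTerm q p.1 * lambertTerm q (p.1 + p.2)) :=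
    b1.summable_weight hq (fun _ => hc _) w2
  have hX1s : Summable fun p : ℕ+ × ℕ+ =>
      (p.1 : ℂ) * p.2 * c (p.1 + p.2) * (lambertTerm q p.1 * lambertTerm q p.2) :=
    bm.summable_weight hq (fun _ => hc _) w1
  have hOcs : Summable fun p : ℕ+ × ℕ+ => (p.1 : ℂ) * (p.1 + p.2) * c (2 * p.1 + p.2) *
      (lambertTerm q p.1 * lambertTerm q (p.1 + p.2)) :=
    b1.summable_weight hq (fun _ => hc _) w2
  have hV1s : Summable fun p : ℕ+ × ℕ+ =>
      (p.1 : ℂ) * p.2 * c (p.1 + p.2) * lambertTerm q (p.1 + p.2) :=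
    ba.summable_weight hq (fun _ => hc _) w1
  have hZs : Summable fun p : ℕ+ × ℕ+ =>
      (p.1 : ℂ) * p.2 * c (p.1 + p.2) * (lambertTerm q p.1 * lambertTerm q (p.1 + p.2)) :=
    b1.summable_weight hq (fun _ => hc _) w1
  have hZs' : Summable fun p : ℕ+ × ℕ+ =>
      (p.1 : ℂ) * p.2 * c (p.1 + p.2) * (lambertTerm q p.2 * lambertTerm q (p.1 + p.2)) :=
    b2.summable_weight hq (fun _ => hc _) w1
  have hCs : Summable fun p : ℕ+ × ℕ+ =>
      ((p.1 : ℂ) * c p.1 * lambertTerm q p.1) * ((p.2 : ℂ) * c p.2 * lambertTerm q p.2) :=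
    summable_mul_of_summable_norm (f := fun n : ℕ+ => (n : ℂ) * c n * lambertTerm q n)
      (g := fun n : ℕ+ => (n : ℂ) * c n * lambertTerm q n) hC.norm hC.norm
  have hDs : Summable fun n : ℕ+ => (n : ℂ) ^ 2 * (lambertTerm q n * lambertTerm q n) :=
    summable_pnat_mul_lambertTerm_mul_self hq (c := fun n => (n : ℂ) ^ 2) (K := 1) (k := 2)
      fun n => by simp
  have hDcs : Summable fun n : ℕ+ =>
      (n : ℂ) ^ 2 * c (2 * n) * (lambertTerm q n * lambertTerm q n) :=
    summable_pnat_mul_lambertTerm_mul_self hq (c := fun n => (n : ℂ) ^ 2 * c (2 * n))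
      (K := 1) (k := 2) fun n => by
        rw [norm_mul]
        exact (mul_le_of_le_one_right (norm_nonneg _) (hc _)).trans_eq (by simp)
  have eC : (∑' n : ℕ+, (n : ℂ) * c n * lambertTerm q n) *
      (∑' n : ℕ+, (n : ℂ) * c n * lambertTerm q n) =
      1 / 2 * ((∑' n : ℕ+, (n : ℂ) ^ 2 * (lambertTerm q n * lambertTerm q n)) +
        ∑' n : ℕ+, (n : ℂ) ^ 2 * c (2 * n) * (lambertTerm q n * lambertTerm q n)) +
      2 * (1 / 2 * ((∑' p : ℕ+ × ℕ+, (p.1 : ℂ) * (p.1 + p.2) * c p.2 *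
        (lambertTerm q p.1 * lambertTerm q (p.1 + p.2))) +
        ∑' p : ℕ+ × ℕ+, (p.1 : ℂ) * (p.1 + p.2) * c (2 * p.1 + p.2) *
          (lambertTerm q p.1 * lambertTerm q (p.1 + p.2)))) := by
    rw [tsum_mul_tsum_of_summable_norm hC.norm hC.norm, tsum_pnat_prod_split hCs, two_mul,
      ← add_assoc, ← hDs.tsum_add hDcs, ← hWs.tsum_add hOcs, ← tsum_mul_left, ← tsum_mul_left]
    congr 1
    · congr 1
      · refine tsum_congr fun m => ?_
        have h := hadd m 0
        rw [hc0, add_zero, add_zero] at h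
        linear_combination ((m : ℂ) ^ 2 * (lambertTerm q m * lambertTerm q m)) * h
      · refine tsum_congr fun p => ?_
        simp only [PNat.add_coe, Nat.cast_add]
        linear_combination ((p.1 : ℂ) * (p.1 + p.2) *
          (lambertTerm q p.1 * lambertTerm q (p.1 + p.2))) * hadd p.1 p.2
    · refine tsum_congr fun p => ?_
      simp only [PNat.add_coe, Nat.cast_add]
      linear_combination ((p.1 : ℂ) * (p.1 + p.2) *
        (lambertTerm q p.1 * lambertTerm q (p.1 + p.2))) * hadd p.1 p.2
  have eX1 : ∑' p : ℕ+ × ℕ+,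
      (p.1 : ℂ) * p.2 * c (p.1 + p.2) * (lambertTerm q p.1 * lambertTerm q p.2) =
      (∑' n : ℕ+, (n : ℂ) ^ 2 * c (2 * n) * (lambertTerm q n * lambertTerm q n)) +
      2 * ∑' p : ℕ+ × ℕ+, (p.1 : ℂ) * (p.1 + p.2) * c (2 * p.1 + p.2) *
        (lambertTerm q p.1 * lambertTerm q (p.1 + p.2)) := by
    rw [tsum_pnat_prod_split hX1s, two_mul, ← add_assoc]
    congr 1
    · congr 1
      · exact tsum_congr fun m => by rw [two_mul, sq]
      · exact tsum_congr fun p => by rw [PNat.add_coe, ← add_assoc, ← two_mul, Nat.cast_add]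
    · refine tsum_congr fun p => ?_
      rw [PNat.add_coe, show (p.1 + p.2 + p.1 : ℕ) = 2 * p.1 + p.2 by ring, Nat.cast_add]
      ring
  have eX1' : ∑' p : ℕ+ × ℕ+,
      (p.1 : ℂ) * p.2 * c (p.1 + p.2) * (lambertTerm q p.1 * lambertTerm q p.2) =
      (∑' p : ℕ+ × ℕ+, (p.1 : ℂ) * p.2 * c (p.1 + p.2) * lambertTerm q (p.1 + p.2)) +
      2 * ∑' p : ℕ+ × ℕ+,
        (p.1 : ℂ) * p.2 * c (p.1 + p.2) * (lambertTerm q p.1 * lambertTerm q (p.1 + p.2)) := by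
    have hsw : ∑' p : ℕ+ × ℕ+,
        (p.1 : ℂ) * p.2 * c (p.1 + p.2) * (lambertTerm q p.1 * lambertTerm q (p.1 + p.2)) =
        ∑' p : ℕ+ × ℕ+,
        (p.1 : ℂ) * p.2 * c (p.1 + p.2) * (lambertTerm q p.2 * lambertTerm q (p.1 + p.2)) := by
      rw [← tsum_pnat_prod_swap]
      exact tsum_congr fun p => by rw [add_comm (p.2 : ℕ), mul_comm (p.2 : ℂ)]
    rw [two_mul, ← add_assoc]
    nth_rewrite 2 [hsw]
    rw [← hV1s.tsum_add hZs, ← (hV1s.add hZs).tsum_add hZs']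
    refine tsum_congr fun p => ?_
    rw [lambertTerm_mul hq]
    ring
  have eW : ∑' p : ℕ+ × ℕ+,
      (p.1 : ℂ) * (p.1 + p.2) * c p.2 * (lambertTerm q p.1 * lambertTerm q (p.1 + p.2)) =
      (∑' p : ℕ+ × ℕ+,
        (p.1 : ℂ) * (p.1 + p.2) * c p.2 * (lambertTerm q p.1 * lambertTerm q p.2)) -
      (∑' p : ℕ+ × ℕ+,
        (p.1 : ℂ) * (p.1 + p.2) * c p.2 * (lambertTerm q p.2 * lambertTerm q (p.1 + p.2))) -
      ∑' p : ℕ+ × ℕ+, (p.1 : ℂ) * (p.1 + p.2) * c p.2 * lambertTerm q (p.1 + p.2) := by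
    rw [← hXs.tsum_sub hYs, ← (hXs.sub hYs).tsum_sub hVs]
    refine tsum_congr fun p => ?_
    rw [lambertTerm_mul_add hq]
    ring
  -- The weight `m(m-k)` vanishes on the diagonal, and the two halves are sums already present in
  -- `eX1'` and `eW`, so they cancel.
  have eG : ∑' p : ℕ+ × ℕ+,
      (p.1 : ℂ) * (p.1 - p.2) * c p.2 * (lambertTerm q p.1 * lambertTerm q p.2) =
      -(∑' p : ℕ+ × ℕ+,
        (p.1 : ℂ) * p.2 * c (p.1 + p.2) * (lambertTerm q p.1 * lambertTerm q (p.1 + p.2))) +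
      ∑' p : ℕ+ × ℕ+,
        (p.1 : ℂ) * (p.1 + p.2) * c p.2 * (lambertTerm q p.2 * lambertTerm q (p.1 + p.2)) := by
    rw [tsum_pnat_prod_split hGs]
    simp only [sub_self, mul_zero, zero_mul, tsum_zero, zero_add]
    rw [← tsum_neg]
    congr 1
    · refine tsum_congr fun p => ?_
      rw [PNat.add_coe, Nat.cast_add]
      ring
    · rw [← tsum_pnat_prod_swap fun p : ℕ+ × ℕ+ =>
        (p.1 : ℂ) * (p.1 + p.2) * c p.2 * (lambertTerm q p.2 * lambertTerm q (p.1 + p.2))]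
      refine tsum_congr fun p => ?_
      rw [PNat.add_coe, Nat.cast_add, add_comm (p.2 : ℕ)]
      ring
  -- The weight difference `m(m+k) - m(m-k) = 2mk` factors over the two indices; it is the source of
  -- the one product of single series in the result.
  have eXG : (∑' p : ℕ+ × ℕ+,
      (p.1 : ℂ) * (p.1 + p.2) * c p.2 * (lambertTerm q p.1 * lambertTerm q p.2)) -
      (∑' p : ℕ+ × ℕ+,
        (p.1 : ℂ) * (p.1 - p.2) * c p.2 * (lambertTerm q p.1 * lambertTerm q p.2)) =
      2 * ((∑' n : ℕ+, (n : ℂ) * lambertTerm q n) *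
        ∑' n : ℕ+, (n : ℂ) * c n * lambertTerm q n) := by
    rw [tsum_mul_tsum_of_summable_norm hS.norm hC.norm, ← hXs.tsum_sub hGs, ← tsum_mul_left]
    exact tsum_congr fun p => by ring
  linear_combination eC + eW + eXG - 1 / 2 * eX1 + 1 / 2 * eX1' + eG

/-! ### Reduction to single Lambert series and the finite sums that arise. -/

theorem tsum_pnat_prod_mul_lambertTerm {q : ℂ} {φ : ℕ → ℕ → ℂ}
    (hφ : Summable fun p : ℕ+ × ℕ+ => φ p.1 p.2 * lambertTerm q (p.1 + p.2)) :
    ∑' p : ℕ+ × ℕ+, φ p.1 p.2 * lambertTerm q (p.1 + p.2) =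
      ∑' N : ℕ+, (∑ k ∈ Finset.Ico 1 (N : ℕ), φ (N - k) k) * lambertTerm q N := by
  rw [tsum_pnat_prod_group (F := fun m k => φ m k * lambertTerm q (m + k)) hφ]
  refine tsum_congr fun N => ?_
  rw [Finset.sum_mul]
  refine Finset.sum_congr rfl fun k hk => ?_
  rw [Nat.sub_add_cancel (Finset.mem_Ico.mp hk).2.le]

theorem sum_Ico_cosThree {N : ℕ} (hN : 1 ≤ N) : ∑ k ∈ Finset.Ico 1 N, cosThree k =
    if N % 3 = 0 then -1 else if N % 3 = 1 then 0 else -1 / 2 := by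
  induction N, hN using Nat.le_induction with
  | base => simp
  | succ n hn ih =>
    rw [Finset.sum_Ico_succ_top hn, ih]
    have : n % 3 = 0 ∨ n % 3 = 1 ∨ n % 3 = 2 := by omega
    rcases this with h | h | h <;> norm_num [cosThree, Nat.add_mod, h]

/-- Raising `N` by one raises every weight `N - k` by one. This is the inductive step for the three
closed forms below. -/
theorem sum_Ico_sub_mul_succ (c : ℕ → ℂ) {N : ℕ} (hN : 1 ≤ N) :
    ∑ k ∈ Finset.Ico 1 (N + 1), (((N + 1 : ℕ) : ℂ) - k) * c k =
      (∑ k ∈ Finset.Ico 1 N, ((N : ℂ) - k) * c k) + ∑ k ∈ Finset.Ico 1 (N + 1), c k := by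
  rw [Finset.sum_Ico_succ_top hN, Finset.sum_Ico_succ_top hN, ← add_assoc,
    ← Finset.sum_add_distrib]
  congr 1
  · refine Finset.sum_congr rfl fun k _ => ?_
    push_cast
    ring
  · push_cast
    ring

theorem sum_Ico_sub_mul_cosThree {N : ℕ} (hN : 1 ≤ N) :
    ∑ k ∈ Finset.Ico 1 N, ((N : ℂ) - k) * cosThree k =
      if N % 3 = 0 then -(N : ℂ) / 2 else -((N : ℂ) - 1) / 2 := by
  induction N, hN using Nat.le_induction with
  | base => simp
  | succ n hn ih =>
    rw [sum_Ico_sub_mul_succ _ hn, ih, sum_Ico_cosThree (by omega)]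
    have : n % 3 = 0 ∨ n % 3 = 1 ∨ n % 3 = 2 := by omega
    rcases this with h | h | h <;> norm_num [Nat.add_mod, h] <;> ring

theorem sum_Ico_sub {N : ℕ} (hN : 1 ≤ N) :
    ∑ k ∈ Finset.Ico 1 N, ((N : ℂ) - k) = (N : ℂ) * (N - 1) / 2 := by
  induction N, hN using Nat.le_induction with
  | base => simp
  | succ n hn ih =>
    have := sum_Ico_sub_mul_succ (fun _ => 1) hn
    simp only [mul_one] at this
    rw [this, ih]
    simp
    ring

theorem sum_Ico_sub_mul {N : ℕ} (hN : 1 ≤ N) :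
    ∑ k ∈ Finset.Ico 1 N, ((N : ℂ) - k) * k = ((N : ℂ) ^ 3 - N) / 6 := by
  have hid (n : ℕ) (hn : 1 ≤ n) : ∑ k ∈ Finset.Ico 1 (n + 1), (k : ℂ) = (n : ℂ) * (n + 1) / 2 := by
    induction n, hn using Nat.le_induction with
    | base => simp
    | succ n hn ih =>
      rw [Finset.sum_Ico_succ_top (by omega), ih]
      push_cast
      ring
  induction N, hN using Nat.le_induction with
  | base => simp
  | succ n hn ih =>
    rw [sum_Ico_sub_mul_succ _ hn, ih, hid n hn]
    push_cast
    ring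

theorem tsum_pnat_ite_three (f : ℕ → ℂ) :
    (∑' N : ℕ+, if (N : ℕ) % 3 = 0 then f N else 0) = ∑' n : ℕ+, f (3 * n) := by
  have hinj : Function.Injective fun n : ℕ+ => 3 * n := fun a b h => mul_left_cancel h
  rw [← hinj.tsum_eq]
  · refine tsum_congr fun n => ?_
    rw [PNat.mul_coe, if_pos (by simp)]
    rfl
  · intro N hN
    have h : (N : ℕ) % 3 = 0 := by
      by_contra hc
      exact hN (if_neg hc)
    have hpos := N.pos
    refine ⟨⟨(N : ℕ) / 3, by omega⟩, PNat.eq ?_⟩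
    exact Nat.mul_div_cancel' (Nat.dvd_of_mod_eq_zero h)

theorem lambertTerm_cube (q : ℂ) (n : ℕ) : lambertTerm (q ^ 3) n = lambertTerm q (3 * n) := by
  rw [lambertTerm, lambertTerm, ← pow_mul]

theorem tsum_pow_mul_lambertTerm {q : ℂ} (hq : ‖q‖ < 1) (k : ℕ) :
    ∑' n : ℕ+, (n : ℂ) ^ k * lambertTerm q n = ∑' n : ℕ+, (σ k n : ℂ) * q ^ (n : ℕ) := by
  simpa only [lambertTerm, mul_div_assoc] using tsum_pow_div_one_sub_eq_tsum_sigma hq k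

/-- With `x = q^d` one has `λ_d + λ_d^2 = x/(1-x)^2 = ∑ c x^c`. Summing over `d` gives the `σ_1`
series, which is also `∑ n λ_n`. -/
theorem tsum_lambertTerm_mul_self {q : ℂ} (hq : ‖q‖ < 1) :
    ∑' n : ℕ+, lambertTerm q n * lambertTerm q n = ∑' n : ℕ+, ((n : ℂ) - 1) * lambertTerm q n := by
  have hu : Summable fun n : ℕ+ => lambertTerm q n := by
    simpa using summable_pnat_mul_lambertTerm hq (c := fun _ => 1) (K := 1) (k := 0) (by simp)
  have hn : Summable fun n : ℕ+ => (n : ℂ) * lambertTerm q n :=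
    summable_pnat_mul_lambertTerm hq (c := fun n => (n : ℂ)) (K := 1) (k := 1) (by simp)
  have hD : Summable fun n : ℕ+ => lambertTerm q n * lambertTerm q n := by
    simpa using summable_pnat_mul_lambertTerm_mul_self hq (c := fun _ => 1) (K := 1) (k := 0)
      (by simp)
  have inner (d : ℕ+) : ∑' c : ℕ+, (c : ℂ) ^ 1 * q ^ (d * c : ℕ) =
      lambertTerm q d + lambertTerm q d * lambertTerm q d := by
    have hd : ‖q ^ (d : ℕ)‖ < 1 := by
      rw [norm_pow]
      exact pow_lt_one₀ (norm_nonneg _) hq d.ne_zero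
    have hne : 1 - q ^ (d : ℕ) ≠ 0 := by
      intro h
      rw [← sub_eq_zero.mp h, norm_one] at hd
      exact lt_irrefl _ hd
    have h := tsum_coe_mul_geometric_of_norm_lt_one hd
    rw [← tsum_zero_pnat_eq_tsum_nat (hasSum_coe_mul_geometric_of_norm_lt_one hd).summable] at h
    simp only [pow_one, pow_mul]
    rw [Nat.cast_zero, zero_mul, zero_add] at h
    rw [h, lambertTerm]
    field_simp
    ring
  have h1 := tsum_prod_pow_eq_tsum_sigma 1 hq
  rw [tsum_congr inner, hu.tsum_add hD, ← tsum_pow_mul_lambertTerm hq 1] at h1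
  simp only [pow_one] at h1
  rw [← add_right_inj (∑' n : ℕ+, lambertTerm q n), h1, ← hu.tsum_add (by
    simpa only [sub_mul, one_mul] using hn.sub hu)]
  exact tsum_congr fun n => by ring

/-- The factor `1 + 2 c_n` is 3 on multiples of 3 and 0 elsewhere, so the sum is the previous one at
`q^3`. -/
theorem tsum_one_add_two_mul_cosThree {q : ℂ} (hq : ‖q‖ < 1) :
    ∑' n : ℕ+, (1 + 2 * cosThree n) * (lambertTerm q n * lambertTerm q n) =
      ∑' N : ℕ+, (if (N : ℕ) % 3 = 0 then (N : ℂ) - 3 else 0) * lambertTerm q N := by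
  have h1 (n : ℕ+) : (1 + 2 * cosThree n) * (lambertTerm q n * lambertTerm q n) =
      if (n : ℕ) % 3 = 0 then 3 * (lambertTerm q n * lambertTerm q n) else 0 := by
    rw [cosThree]
    split_ifs <;> ring
  have h2 (n : ℕ+) : (if (n : ℕ) % 3 = 0 then (n : ℂ) - 3 else 0) * lambertTerm q n =
      if (n : ℕ) % 3 = 0 then ((n : ℂ) - 3) * lambertTerm q n else 0 := by
    split_ifs <;> ring
  rw [tsum_congr h1, tsum_congr h2,
    tsum_pnat_ite_three fun n => 3 * (lambertTerm q n * lambertTerm q n),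
    tsum_pnat_ite_three fun n => ((n : ℂ) - 3) * lambertTerm q n, tsum_mul_left]
  simp only [← lambertTerm_cube]
  rw [tsum_lambertTerm_mul_self (norm_cube_lt_one hq), ← tsum_mul_left]
  refine tsum_congr fun n => ?_
  push_cast
  ring

theorem hasSum_pow_mul_bounded_mul_lambertTerm {q : ℂ} (hq : ‖q‖ < 1) {c : ℕ → ℂ}
    (hc : ∀ n, ‖c n‖ ≤ 1) (k : ℕ) :
    HasSum (fun n : ℕ+ => (n : ℂ) ^ k * c n * lambertTerm q n)
      (∑' n : ℕ+, (n : ℂ) ^ k * c n * lambertTerm q n) :=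
  (summable_pnat_mul_lambertTerm hq (c := fun n => (n : ℂ) ^ k * c n) (K := 1) (k := k) fun n => by
    rw [norm_mul, one_mul]
    exact (mul_le_of_le_one_right (norm_nonneg _) (hc _)).trans_eq (by simp)).hasSum

theorem hasSum_pow_mul_lambertTerm {q : ℂ} (hq : ‖q‖ < 1) (k : ℕ) :
    HasSum (fun n : ℕ+ => (n : ℂ) ^ k * lambertTerm q n)
      (∑' n : ℕ+, (n : ℂ) ^ k * lambertTerm q n) := by
  simpa using hasSum_pow_mul_bounded_mul_lambertTerm hq (c := fun _ => 1) (by simp) k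

/-! ### The second and fourth powers of the cubic theta function. -/

/-- The square of the cubic theta function as a Lambert series. -/
theorem cubicTheta_sq {q : ℂ} (hq : ‖q‖ < 1) :
    cubicTheta q ^ 2 = 1 + 8 * ((∑' n : ℕ+, (n : ℂ) * lambertTerm q n) -
      ∑' n : ℕ+, (n : ℂ) * cosThree n * lambertTerm q n) := by
  have hc := norm_cosThree_le
  have hχ (n : ℕ) : ‖chiThree n‖ ≤ 1 * (n : ℝ) ^ 0 := by simpa using norm_chiThree_le n
  have ba := geometricallyBounded_add hq
  have hL : cubicTheta q = 1 + 6 * ∑' n : ℕ+, chiThree n * lambertTerm q n := by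
    rw [cubicTheta_eq_lambert hq, ← tsum_zero_pnat_eq_tsum_nat (summable_mul_lambertTerm hq hχ)]
    simp [chiThree]
  have hV := tsum_pnat_prod_mul_lambertTerm (q := q) (φ := fun _ k => cosThree k)
    (ba.summable_bounded hq fun _ => hc _)
  have hV1 := tsum_pnat_prod_mul_lambertTerm (q := q) (φ := fun m k => cosThree (m + k))
    (ba.summable_bounded hq fun _ => hc _)
  have key := tsum_chiThree_mul_self hq
  have a0 := hasSum_pow_mul_lambertTerm hq 0
  have a1 := hasSum_pow_mul_lambertTerm hq 1
  have c0 := hasSum_pow_mul_bounded_mul_lambertTerm hq hc 0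
  have c1 := hasSum_pow_mul_bounded_mul_lambertTerm hq hc 1
  have l0 := hasSum_pow_mul_bounded_mul_lambertTerm hq norm_chiThree_le 0
  simp only [pow_zero, pow_one, one_mul] at a0 a1 c0 c1 l0
  have e1 := (((a1.add (c1.mul_left 2)).sub ((a0.add (c0.mul_left 2)).mul_left 3)).mul_left
    (1 / 3 : ℂ)).tsum_eq
  have e2 := ((l0.mul_left (1 / 4 : ℂ)).sub ((a0.add c0).mul_left (1 / 2))).tsum_eq
  have e3 := (c1.sub c0).tsum_eq
  have f1 (N : ℕ+) : (if (N : ℕ) % 3 = 0 then (N : ℂ) - 3 else 0) * lambertTerm q N =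
      1 / 3 * ((N : ℂ) * lambertTerm q N + 2 * ((N : ℂ) * cosThree N * lambertTerm q N) -
        3 * (lambertTerm q N + 2 * (cosThree N * lambertTerm q N))) := by
    rw [cosThree]
    split_ifs <;> ring
  have f2 (N : ℕ+) : (∑ k ∈ Finset.Ico 1 (N : ℕ), cosThree k) * lambertTerm q N =
      1 / 4 * (chiThree N * lambertTerm q N) -
        1 / 2 * (lambertTerm q N + cosThree N * lambertTerm q N) := by
    rw [sum_Ico_cosThree N.pos, cosThree, chiThree]
    split_ifs <;> ring
  have f3 (N : ℕ+) : (∑ k ∈ Finset.Ico 1 (N : ℕ), cosThree (N - k + k)) * lambertTerm q N =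
      (N : ℂ) * cosThree N * lambertTerm q N - cosThree N * lambertTerm q N := by
    rw [Finset.sum_congr rfl fun k hk => by
      rw [Nat.sub_add_cancel (Finset.mem_Ico.mp hk).2.le], Finset.sum_const, Nat.card_Ico,
      nsmul_eq_mul, Nat.cast_sub N.pos]
    push_cast
    ring
  rw [hV, hV1, tsum_one_add_two_mul_cosThree hq, tsum_congr f1, tsum_congr f2, tsum_congr f3,
    e1, e2, e3] at key
  rw [hL]
  -- The `χ` part of `36 (∑ χ(n) λ_n)^2` is `-12 ∑ χ(n) λ_n`, which cancels the cross term of the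
  -- square.
  linear_combination 36 * key

/-- In `(C^2 - 2SC) - (S^2 - 2S^2) = (S - C)^2` the series in `n^2 λ_n^2` and `n^2 λ_n` drop out.
The remaining first-power part, `-16(S - C)` after scaling by 64, cancels the cross term of `(1 +
8(S - C))^2`. -/
theorem cubicTheta_pow_four_eq_lambert {q : ℂ} (hq : ‖q‖ < 1) :
    cubicTheta q ^ 4 = 1 + 80 / 3 * (∑' n : ℕ+, (n : ℂ) ^ 3 * lambertTerm q n) +
      16 / 3 * ∑' n : ℕ+, (n : ℂ) ^ 3 * cosThree n * lambertTerm q n := by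
  have hc := norm_cosThree_le
  have h1 : ∀ n : ℕ, ‖(fun _ => 1 : ℕ → ℂ) n‖ ≤ 1 := by simp
  have w1 := fun p => (weight_bounds p).1
  have w2 := fun p => (weight_bounds p).2.1
  have ba := geometricallyBounded_add hq
  have V1 (c : ℕ → ℂ) (hc : ∀ n, ‖c n‖ ≤ 1) := tsum_pnat_prod_mul_lambertTerm (q := q)
    (φ := fun m k => (m : ℂ) * k * c (m + k)) (ba.summable_weight hq (fun _ => hc _) w1)
  have V2 (c : ℕ → ℂ) (hc : ∀ n, ‖c n‖ ≤ 1) := tsum_pnat_prod_mul_lambertTerm (q := q)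
    (φ := fun m k => (m : ℂ) * (m + k) * c k) (ba.summable_weight hq (fun _ => hc _) w2)
  have kc := tsum_mul_lambertTerm_mul_self hq hc (by simp [cosThree]) cosThree_mul_cosThree_add
  have k1 := tsum_mul_lambertTerm_mul_self hq h1 rfl (by simp)
  have a1 := hasSum_pow_mul_lambertTerm hq 1
  have a2 := hasSum_pow_mul_lambertTerm hq 2
  have a3 := hasSum_pow_mul_lambertTerm hq 3
  have c1 := hasSum_pow_mul_bounded_mul_lambertTerm hq hc 1
  have c3 := hasSum_pow_mul_bounded_mul_lambertTerm hq hc 3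
  simp only [pow_one] at a1 c1
  have f1 (c : ℕ → ℂ) (N : ℕ+) :
      (∑ k ∈ Finset.Ico 1 (N : ℕ), ((N - k : ℕ) : ℂ) * k * c (N - k + k)) * lambertTerm q N =
      1 / 6 * ((N : ℂ) ^ 3 * c N * lambertTerm q N - (N : ℂ) * c N * lambertTerm q N) := by
    have : ∑ k ∈ Finset.Ico 1 (N : ℕ), ((N - k : ℕ) : ℂ) * k * c (N - k + k) =
        (∑ k ∈ Finset.Ico 1 (N : ℕ), ((N : ℂ) - k) * k) * c N := by
      rw [Finset.sum_mul]
      refine Finset.sum_congr rfl fun k hk => ?_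
      have hk' := (Finset.mem_Ico.mp hk).2.le
      rw [Nat.sub_add_cancel hk', Nat.cast_sub hk']
    rw [this, sum_Ico_sub_mul N.pos]
    ring
  have f2 (c : ℕ → ℂ) (N : ℕ+) :
      (∑ k ∈ Finset.Ico 1 (N : ℕ), ((N - k : ℕ) : ℂ) * ((N - k : ℕ) + k) * c k) =
      N * ∑ k ∈ Finset.Ico 1 (N : ℕ), ((N : ℂ) - k) * c k := by
    rw [Finset.mul_sum]
    refine Finset.sum_congr rfl fun k hk => ?_
    rw [Nat.cast_sub (Finset.mem_Ico.mp hk).2.le]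
    ring
  have f21 (N : ℕ+) : (∑ k ∈ Finset.Ico 1 (N : ℕ),
      ((N - k : ℕ) : ℂ) * ((N - k : ℕ) + k) * (fun _ => 1 : ℕ → ℂ) k) * lambertTerm q N =
      1 / 2 * ((N : ℂ) ^ 3 * lambertTerm q N - (N : ℂ) ^ 2 * lambertTerm q N) := by
    rw [f2]
    simp only [mul_one]
    rw [sum_Ico_sub N.pos]
    ring
  have f2c (N : ℕ+) : (∑ k ∈ Finset.Ico 1 (N : ℕ),
      ((N - k : ℕ) : ℂ) * ((N - k : ℕ) + k) * cosThree k) * lambertTerm q N =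
      1 / 3 * ((N : ℂ) * lambertTerm q N - (N : ℂ) * cosThree N * lambertTerm q N) -
        1 / 2 * ((N : ℂ) ^ 2 * lambertTerm q N) := by
    rw [f2, sum_Ico_sub_mul_cosThree N.pos, cosThree]
    split_ifs <;> ring
  rw [V1 _ hc, V2 _ hc, tsum_congr (f1 _), tsum_congr f2c, ((c3.sub c1).mul_left _).tsum_eq,
    (((a1.sub c1).mul_left _).sub (a2.mul_left _)).tsum_eq] at kc
  have f11 := f1 fun _ => 1
  rw [V1 _ h1, V2 _ h1] at k1
  simp only [mul_one] at k1 f11 f21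
  rw [tsum_congr f11, tsum_congr f21, ((a3.sub a1).mul_left _).tsum_eq, ((a3.sub a2).mul_left _).tsum_eq] at k1
  rw [show cubicTheta q ^ 4 = (cubicTheta q ^ 2) ^ 2 by ring, cubicTheta_sq hq]
  linear_combination 64 * kc - 64 * k1

/-- The coefficient `80/3 + (16/3) c_n` equals 24, plus 8 when `3 ∣ n`; putting `n = 3m` turns `8
n^3` into `216 m^3`. -/
theorem cubicTheta_pow_four {q : ℂ} (hq : ‖q‖ < 1) :
    cubicTheta q ^ 4 = 1 + 24 * (∑' n : ℕ+, (σ 3 n : ℂ) * q ^ (n : ℕ)) +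
      216 * ∑' n : ℕ+, (σ 3 n : ℂ) * (q ^ 3) ^ (n : ℕ) := by
  have a3 := hasSum_pow_mul_lambertTerm hq 3
  have c3 := hasSum_pow_mul_bounded_mul_lambertTerm hq norm_cosThree_le 3
  have h := (a3.add (c3.mul_left 2)).tsum_eq
  have f (N : ℕ+) : (N : ℂ) ^ 3 * lambertTerm q N + 2 * ((N : ℂ) ^ 3 * cosThree N * lambertTerm q N) =
      if (N : ℕ) % 3 = 0 then 3 * (N : ℂ) ^ 3 * lambertTerm q N else 0 := by
    rw [cosThree]
    split_ifs <;> ring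
  have g (n : ℕ+) : 3 * ((3 * n : ℕ) : ℂ) ^ 3 * lambertTerm q (3 * n) =
      81 * ((n : ℂ) ^ 3 * lambertTerm (q ^ 3) n) := by
    rw [lambertTerm_cube]
    push_cast
    ring
  rw [tsum_congr f, tsum_pnat_ite_three fun N => 3 * (N : ℂ) ^ 3 * lambertTerm q N, tsum_congr g,
    tsum_mul_left] at h
  rw [← tsum_pow_mul_lambertTerm hq, ← tsum_pow_mul_lambertTerm (norm_cube_lt_one hq),
    cubicTheta_pow_four_eq_lambert hq]
  linear_combination -(8 / 3 : ℂ) * h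

/-! ### Divisor sums of rational arguments and the conclusion. -/

theorem sigmaRat_natCast (k n : ℕ) : sigmaRat k (n : ℚ) = σ k n := by
  rcases n with _ | n
  · simp [sigmaRat]
  · rw [sigmaRat, if_pos ⟨Rat.den_natCast _, by positivity⟩, Rat.num_natCast, Int.toNat_natCast]

theorem sigmaRat_div_three (k : ℕ) (n : ℕ+) :
    sigmaRat k (((n : ℕ) : ℚ) / 3) = if (n : ℕ) % 3 = 0 then σ k (n / 3 : ℕ) else 0 := by
  split_ifs with h
  · obtain ⟨m, hm⟩ := Nat.dvd_of_mod_eq_zero h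
    have e : ((n : ℕ) : ℚ) / 3 = m := by
      rw [hm]
      push_cast
      simp
    rw [e, sigmaRat_natCast, hm, Nat.mul_div_cancel_left _ (by norm_num)]
  · rw [sigmaRat, if_neg]
    rintro ⟨hd, -⟩
    have e := Rat.num_div_den (((n : ℕ) : ℚ) / 3)
    rw [hd, Nat.cast_one, div_one, eq_div_iff (by norm_num)] at e
    have e' : (((n : ℕ) : ℚ) / 3).num * 3 = (n : ℕ) := by exact_mod_cast e
    omega

theorem summable_sigma_mul_pow {q : ℂ} (hq : ‖q‖ < 1) (k : ℕ) :
    Summable fun n : ℕ+ => (σ k n : ℂ) * q ^ (n : ℕ) := by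
  have hs : Summable fun n : ℕ+ => (n : ℝ) ^ (k + 1) * ‖q‖ ^ (n : ℕ) :=
    (summable_pow_mul_geometric_of_norm_lt_one (R := ℝ) (k + 1) (r := ‖q‖)
      (by simpa using hq)).comp_injective PNat.coe_injective
  refine Summable.of_norm_bounded hs fun n => ?_
  rw [norm_mul, norm_pow, Complex.norm_natCast]
  gcongr
  exact_mod_cast ArithmeticFunction.sigma_le_pow_succ k n

theorem hasSum_sigma_div_three {q : ℂ} (hq : ‖q‖ < 1) :
    HasSum (fun n : ℕ+ => (sigmaRat 3 (((n : ℕ) : ℚ) / 3) : ℂ) * q ^ (n : ℕ))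
      (∑' n : ℕ+, (σ 3 n : ℂ) * (q ^ 3) ^ (n : ℕ)) := by
  have hf (n : ℕ+) : (sigmaRat 3 (((n : ℕ) : ℚ) / 3) : ℂ) * q ^ (n : ℕ) =
      if (n : ℕ) % 3 = 0 then (σ 3 (n / 3 : ℕ) : ℂ) * q ^ (n : ℕ) else 0 := by
    rw [sigmaRat_div_three]
    split_ifs <;> simp
  have hs : Summable fun n : ℕ+ => (sigmaRat 3 (((n : ℕ) : ℚ) / 3) : ℂ) * q ^ (n : ℕ) := by
    refine Summable.of_norm_bounded (summable_sigma_mul_pow hq 3).norm fun n => ?_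
    rw [hf]
    split_ifs with h
    · rw [norm_mul, norm_mul, Complex.norm_natCast, Complex.norm_natCast]
      gcongr
      rw [ArithmeticFunction.sigma_apply, ArithmeticFunction.sigma_apply]
      -- The bound `σ_3(n/3) ≤ σ_3(n)` holds because every divisor of `n/3` divides `n`.
      exact Finset.sum_le_sum_of_subset
        (Nat.divisors_subset_of_dvd n.ne_zero (Nat.div_dvd_of_dvd (Nat.dvd_of_mod_eq_zero h)))
    · simp
  convert hs.hasSum using 1
  rw [tsum_congr hf, tsum_pnat_ite_three fun n => (σ 3 (n / 3 : ℕ) : ℂ) * q ^ (n : ℕ)]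
  refine tsum_congr fun n => ?_
  rw [Nat.mul_div_cancel_left _ (by norm_num), pow_mul]

theorem mainTheorem10 (q : ℂ) (hq : ‖q‖ < 1) :
    Summable (cubicThetaTerm q) ∧
    Summable (fun n : ℕ+ =>
      ((sigmaRat 3 (n : ℕ) : ℂ) + 9 * (sigmaRat 3 (((n : ℕ) : ℚ) / 3) : ℂ)) * q ^ (n : ℕ)) ∧
    cubicTheta q ^ 4 =
      1 + 24 * ∑' n : ℕ+,
        ((sigmaRat 3 (n : ℕ) : ℂ) + 9 * (sigmaRat 3 (((n : ℕ) : ℚ) / 3) : ℂ)) * q ^ (n : ℕ) ∧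
    Summable (fun n : ℕ+ => (sigmaRat 3 (n : ℕ) : ℂ) * q ^ (n : ℕ)) ∧
    Summable (fun n : ℕ+ => (sigmaRat 3 (n : ℕ) : ℂ) * (q ^ 3) ^ (n : ℕ)) ∧
    10 * cubicTheta q ^ 4 = eisensteinFour q + 9 * eisensteinFour (q ^ 3) := by
  have hq3 := norm_cube_lt_one hq
  have h1 := summable_sigma_mul_pow hq 3
  have h3 := summable_sigma_mul_pow hq3 3
  have hd := hasSum_sigma_div_three hq
  have hsum := h1.hasSum.add (hd.mul_left 9)
  have hcongr : (fun n : ℕ+ => (σ 3 n : ℂ) * q ^ (n : ℕ) +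
      9 * ((sigmaRat 3 (((n : ℕ) : ℚ) / 3) : ℂ) * q ^ (n : ℕ))) = fun n : ℕ+ =>
      ((sigmaRat 3 (n : ℕ) : ℂ) + 9 * (sigmaRat 3 (((n : ℕ) : ℚ) / 3) : ℂ)) * q ^ (n : ℕ) := by
    funext n
    rw [sigmaRat_natCast]
    ring
  rw [hcongr] at hsum
  simp only [eisensteinFour, sigmaRat_natCast]
  simp only [sigmaRat_natCast] at hsum
  refine ⟨summable_cubicThetaTerm hq, hsum.summable, ?_, h1, h3, ?_⟩
  · rw [hsum.tsum_eq, cubicTheta_pow_four hq]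
    ring
  -- The coefficients match: `10 = 1 + 9`, `10 · 24 = 240` and `10 · 216 = 9 · 240`.
  · rw [cubicTheta_pow_four hq]
    ring
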